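/- **Theorem 1.** Fix a dimension $D$ and spins with local Hilbert space $\mathbb C^q$. For $L\ge 3$ consider the periodic lattice $\Lambda_L=\mathbb Z_L^D$ with its graph distance, and the spin system on it, with operators acting on $\bigotimes_{u\in\Lambda_L}\mathbb C^q$ and $\|\cdot\|$ the operator norm. A superoperator (linear map on operators) $T$ is of *Lindblad form* if $$T(A)=i[H,A]+\sum_j\Big[K_j^\dagger A K_j-\tfrac12\big(K_j^\dagger K_jA+AK_j^\dagger K_j\big)\Big]$$ with $H$ Hermitian and finitely many operators $K_j$; its completely bounded norm is $\|T\|_{cb}=\sup_n\|T\otimes\mathrm{id}_n\|$. A superoperator is supported on $\Gamma\subset\Lambda_L$ if it is of the form $T'\otimes\mathrm{id}$ with $T'$ acting on the sites in $\Gamma$. Let $\ell$ be a superoperator of Lindblad form with $\|\ell\|_{cb}\le 1$, acting on the $2D+1$ sites consisting of a site and its nearest neighbours. For every $L\ge 3$ let $L_u$ be its translate to $u\in\Lambda_L$ (tensored with the identity on the other sites) and $\mathcal L=\mathcal L^{(L)}=\sum_{u\in\Lambda_L}L_u$. Assume: * (unique fixed point) for every $L\ge3$ there is a density matrix $\rho_\infty=\rho_\infty^{(L)}$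 such that $\lim_{t\to\infty}e^{t\mathcal L}(A)=\operatorname{tr}(A\rho_\infty)\mathbb 1=:A(\infty)$ for all operators $A$ on $\Lambda_L$; * (rapid mixing) there are constants $c,\delta,\gamma>0$ such that for all $L\ge3$, all operators $A$ on $\Lambda_L$ and all $t\ge0$, $$\|e^{t\mathcal L}(A)-A(\infty)\|\le c\,L^\delta e^{-\gamma t}\|A\|.$$ Then for every finite region $X\subset\mathbb Z^D$ (which need not be connected) and every range $r\in\mathbb N$ there is a constant $C_X>0$ such that the following holds for all $L\ge 3$, all $\epsilon\ge0$ and all families $(E_u)_{u\in\Lambda_L}$ of superoperators such that, for each $u$, $E_u$ is supported on the ball of radius $r$ around $u$, $L_u+E_u$ is of Lindblad form, and $\|E_u\|_{cb}\le\epsilon$. Let $\tilde{\mathcal L}=\mathcal L+\sum_{u\in\Lambda_L}E_u$. 1. For every observable $A$ supported on the image of $X$ in $\Lambda_L$ and all $t\ge0$, $$\|e^{t\mathcal L}(A)-e^{t\tilde{\mathcal L}}(A)\|\le C_X\|A\|\,\epsilon .$$ 2. For every $k$, all sites $x_1,\dots,x_k\in X$, all observables $B_j$ supported on the image of $x_j$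 in $\Lambda_L$, every density matrix $\sigma$ on $\Lambda_L$ and all $t\ge0$, the $k$-point correlation functions satisfy $$\big|\operatorname{tr}\big(\sigma\,e^{t\mathcal L}(B_1\cdots B_k)\big)-\operatorname{tr}\big(\sigma\,e^{t\tilde{\mathcal L}}(B_1\cdots B_k)\big)\big|\le C_X\,\|B_1\|\cdots\|B_k\|\,\epsilon .$$ The constant $C_X$ does not depend on the system size $L$, the time $t$, the strength $\epsilon$ or the choice of the perturbation. -/

import Mathlib

open scoped Matrix.Norms.L2Operator ComplexOrder Topology

noncomputable section

/-! Superoperators on matrix algebras: Lindblad form, completely bounded norm, time evolution. -/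

/-- Superoperators: linear maps from the operators on `ℂ^ι` to themselves. -/
abbrev SuperOp (ι : Type) : Type := Matrix ι ι ℂ →ₗ[ℂ] Matrix ι ι ℂ

/-- `T` has Lindblad form in the Heisenberg picture:
`T(A) = i[H, A] + ∑ j, (Kⱼ* A Kⱼ - ½ (Kⱼ* Kⱼ A + A Kⱼ* Kⱼ))` with `H` Hermitian. -/
def IsLindblad {ι : Type} [Fintype ι] (T : SuperOp ι) : Prop :=
  ∃ H : Matrix ι ι ℂ, H.IsHermitian ∧ ∃ (m : ℕ) (K : Fin m → Matrix ι ι ℂ),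
    ∀ A : Matrix ι ι ℂ, T A = Complex.I • (H * A - A * H) +
      ∑ j, ((K j).conjTranspose * A * K j -
        (1 / 2 : ℂ) • ((K j).conjTranspose * K j * A + A * ((K j).conjTranspose * K j)))

/-- The ampliation `T ⊗ id_n`, acting on operators on `ℂ^ι ⊗ ℂ^n` blockwise. -/
def ampliation {ι : Type} (T : SuperOp ι) (n : ℕ) : SuperOp (ι × Fin n) where
  toFun M := Matrix.of fun x y =>
    T (Matrix.of fun i j => M (i, x.2) (j, y.2)) x.1 y.1
  map_add' M N := by
    ext x y
    have h : (Matrix.of fun i j => (M + N) (i, x.2) (j, y.2)) =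
        (Matrix.of fun i j => M (i, x.2) (j, y.2)) +
          (Matrix.of fun i j => N (i, x.2) (j, y.2)) := by
      ext i j; simp
    rw [Matrix.of_apply, h, map_add]; rfl
  map_smul' a M := by
    ext x y
    have h : (Matrix.of fun i j => (a • M) (i, x.2) (j, y.2)) =
        a • (Matrix.of fun i j => M (i, x.2) (j, y.2)) := by
      ext i j; simp
    rw [Matrix.of_apply, h, map_smul]; rfl

/-- The completely bounded norm `sup_n ‖T ⊗ id_n‖`, where `‖S‖ = sup_{‖M‖ ≤ 1} ‖S(M)‖` is the norm
of superoperators induced by the operator norm of matrices. -/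
def cbNorm {ι : Type} [Fintype ι] [DecidableEq ι] (T : SuperOp ι) : ENNReal :=
  ⨆ (n : ℕ) (M : Matrix (ι × Fin n) (ι × Fin n) ℂ) (_ : ‖M‖ ≤ 1),
    ENNReal.ofReal ‖ampliation T n M‖

/-- The Heisenberg evolution `e^{tT}(A) = ∑ n, tⁿ/n! Tⁿ(A)`. -/
def evolve {ι : Type} [Fintype ι] [DecidableEq ι] (T : SuperOp ι) (t : ℝ)
    (A : Matrix ι ι ℂ) : Matrix ι ι ℂ :=
  ∑' n : ℕ, ((t : ℂ) ^ n / (n.factorial : ℂ)) • (T ^ n) A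

/-- Density matrices. -/
def IsDensity {ι : Type} [Fintype ι] (ρ : Matrix ι ι ℂ) : Prop :=
  ρ.PosSemidef ∧ ρ.trace = 1

/-- `ρ` is the unique fixed point of the dynamics generated by `T`: in the Heisenberg picture,
`lim_{t → ∞} e^{tT}(A) = tr(A ρ) 1` for every `A`. -/
def IsUniqueFixedPoint {ι : Type} [Fintype ι] [DecidableEq ι] (T : SuperOp ι)
    (ρ : Matrix ι ι ℂ) : Prop :=
  IsDensity ρ ∧ ∀ A : Matrix ι ι ℂ,
    Filter.Tendsto (fun t : ℝ => evolve T t A) Filter.atTop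
      (𝓝 ((A * ρ).trace • (1 : Matrix ι ι ℂ)))

/-! Spin systems with `q` levels per site. For a set of sites `Λ`, the basis of the Hilbert space
`⊗_{x ∈ Λ} ℂ^q` is indexed by the configurations `Λ → Fin q`. -/

/-- Given an injection `f : S → Λ`, the superoperator `T ⊗ id` on the operators of the system `Λ`,
where `T` acts on the sites `f(S)` and `id` on all others. Here `Function.extend f s σ` is the
configuration that agrees with `s` on `f(S)` and with `σ` elsewhere. -/
def embedSuper {S Λ : Type} {q : ℕ} (f : S → Λ) (T : SuperOp (S → Fin q)) :
    SuperOp (Λ → Fin q) where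
  toFun A := Matrix.of fun σ τ =>
    T (Matrix.of fun s s' => A (Function.extend f s σ) (Function.extend f s' τ)) (σ ∘ f) (τ ∘ f)
  map_add' A B := by
    ext σ τ
    have h : (Matrix.of fun s s' =>
          (A + B) (Function.extend f s σ) (Function.extend f s' τ)) =
        (Matrix.of fun s s' => A (Function.extend f s σ) (Function.extend f s' τ)) +
          (Matrix.of fun s s' => B (Function.extend f s σ) (Function.extend f s' τ)) := by
      ext i j; simp
    rw [Matrix.of_apply, h, map_add]; rfl
  map_smul' a A := by
    ext σ τ
    have h : (Matrix.of fun s s' =>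
          (a • A) (Function.extend f s σ) (Function.extend f s' τ)) =
        a • (Matrix.of fun s s' => A (Function.extend f s σ) (Function.extend f s' τ)) := by
      ext i j; simp
    rw [Matrix.of_apply, h, map_smul]; rfl

open Classical in
/-- Given an injection `f : S → Λ`, the operator `B ⊗ 1` of the system `Λ`, where `B` acts on the
sites `f(S)` and `1` on all others. -/
def embedObs {S Λ : Type} {q : ℕ} (f : S → Λ) (B : Matrix (S → Fin q) (S → Fin q) ℂ) :
    Matrix (Λ → Fin q) (Λ → Fin q) ℂ :=
  Matrix.of fun σ τ => if ∀ x, x ∉ Set.range f → σ x = τ x then B (σ ∘ f) (τ ∘ f) else 0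

/-- The operator `A` is supported on `X`: it is of the form `B ⊗ 1` with `B` acting on `X`. -/
def ObsSupportedOn {Λ : Type} {q : ℕ} (X : Set Λ)
    (A : Matrix (Λ → Fin q) (Λ → Fin q) ℂ) : Prop :=
  ∃ B : Matrix (X → Fin q) (X → Fin q) ℂ, A = embedObs (Subtype.val : X → Λ) B

/-- The superoperator `T` is supported on `Γ`: it is of the form `T' ⊗ id` with `T'` acting
on `Γ`. -/
def SuperSupportedOn {Λ : Type} {q : ℕ} (Γ : Set Λ) (T : SuperOp (Λ → Fin q)) : Prop :=
  ∃ T' : SuperOp (Γ → Fin q), T = embedSuper (Subtype.val : Γ → Λ) T'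

/-! The periodic lattice and the translation-invariant nearest-neighbour Liouvillian. -/

/-- The periodic lattice `ℤ_L^D`. -/
abbrev Torus (D L : ℕ) : Type := Fin D → ZMod L

/-- The configurations of `q`-level spins on `ℤ_L^D`. -/
abbrev Config (D L q : ℕ) : Type := Torus D L → Fin q

/-- The operators of the spin system on `ℤ_L^D`. -/
abbrev Obs (D L q : ℕ) : Type := Matrix (Config D L q) (Config D L q) ℂ

/-- Reduction modulo `L`, from `ℤ^D` to `ℤ_L^D`. -/
def toTorus {D : ℕ} (L : ℕ) (x : Fin D → ℤ) : Torus D L := fun i => (x i : ZMod L)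

/-- The graph distance on `ℤ_L^D`. -/
def torusDist {D L : ℕ} (u v : Torus D L) : ℕ := ∑ i, (v i - u i).valMinAbs.natAbs

/-- The `2D + 1` sites of the neighbourhood of a site: the site itself (`none`) and its neighbours
in the directions `+eᵢ` (`some (i, true)`) and `-eᵢ` (`some (i, false)`). -/
abbrev NbhdSite (D : ℕ) : Type := Option (Fin D × Bool)

/-- The displacement of a point of the neighbourhood from its centre. -/
def nbhdVec {D : ℕ} : NbhdSite D → Fin D → ℤ
  | none => 0
  | some (i, true) => Pi.single i 1
  | some (i, false) => Pi.single i (-1)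

/-- The translate to `u ∈ ℤ_L^D` of the local term `ℓ`, acting on `u` and its nearest neighbours
(which are `2D + 1` distinct sites when `L ≥ 3`). -/
def localTerm {D q : ℕ} (ℓ : SuperOp (NbhdSite D → Fin q)) (L : ℕ) (u : Torus D L) :
    SuperOp (Config D L q) :=
  embedSuper (fun a : NbhdSite D => u + toTorus L (nbhdVec a)) ℓ

/-- The translation-invariant nearest-neighbour Liouvillian on `ℤ_L^D` with local term `ℓ`. -/
def liouvillian {D q : ℕ} (ℓ : SuperOp (NbhdSite D → Fin q)) (L : ℕ) [NeZero L] :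
    SuperOp (Config D L q) :=
  ∑ u : Torus D L, localTerm ℓ L u

end

/-- The resolvent form of dissipativity: `1 - h T` does not decrease norms for `h ≥ 0`. -/
def Dissipative {V : Type*} [NormedAddCommGroup V] [NormedSpace ℂ V] (T : V →ₗ[ℂ] V) : Prop :=
  ∀ h : ℝ, 0 ≤ h → ∀ x : V, ‖x‖ ≤ ‖x - h • T x‖

section Hilbert

variable {E : Type*} [NormedAddCommGroup E] [InnerProductSpace ℂ E] [FiniteDimensional ℂ E]

lemma exists_unit_norm_apply_eq_opNorm (A : E →L[ℂ] E) (hA : A ≠ 0) :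
    ∃ ψ : E, ‖ψ‖ = 1 ∧ ‖A ψ‖ = ‖A‖ := by
  have : Nontrivial E := by
    by_contra h
    rw [not_nontrivial_iff_subsingleton] at h
    exact hA (Subsingleton.elim _ _)
  have hcomp : IsCompact (Metric.sphere (0 : E) 1) := by
    have : ProperSpace E := FiniteDimensional.proper ℂ E
    exact isCompact_sphere 0 1
  have hne : (Metric.sphere (0 : E) 1).Nonempty := by
    have := NormedSpace.sphere_nonempty_rclike ℂ (E := E) (r := 1) zero_le_one
    exact Set.nonempty_coe_sort.mp this
  obtain ⟨ψ, hψ, hmax⟩ := hcomp.exists_isMaxOn hne (f := fun x => ‖A x‖)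
    (by fun_prop)
  have h1 : ‖ψ‖ = 1 := by simpa using hψ
  refine ⟨ψ, h1, le_antisymm (by simpa [h1] using A.le_opNorm ψ) ?_⟩
  refine A.opNorm_le_bound (norm_nonneg _) fun x => ?_
  by_cases hx : x = 0
  · simp [hx]
  have hx' : ‖x‖ ≠ 0 := by simpa using hx
  have : ‖A ((‖x‖⁻¹ : ℂ) • x)‖ ≤ ‖A ψ‖ := hmax (by simp [norm_smul, hx'])
  rw [map_smul, norm_smul] at this
  simp only [norm_inv, Complex.norm_real, norm_norm] at this
  rwa [inv_mul_le_iff₀ (by positivity), mul_comm] at this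

lemma adjoint_apply_apply_of_norm_attained (A : E →L[ℂ] E) {ψ : E} (h1 : ‖ψ‖ = 1)
    (hψ : ‖A ψ‖ = ‖A‖) :
    (star A) (A ψ) = ((‖A‖ ^ 2 : ℝ) : ℂ) • ψ := by
  rw [← sub_eq_zero, ← norm_eq_zero, ← sq_eq_zero_iff]
  refine le_antisymm ?_ (by positivity)
  rw [@norm_sub_sq ℂ, inner_smul_right, ContinuousLinearMap.star_eq_adjoint,
    ContinuousLinearMap.adjoint_inner_left, inner_self_eq_norm_sq_to_K, norm_smul, h1, hψ]
  have h2 : ‖(ContinuousLinearMap.adjoint A) (A ψ)‖ ≤ ‖A‖ * ‖A‖ := by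
    have := (ContinuousLinearMap.adjoint A).le_opNorm (A ψ)
    rwa [hψ, LinearIsometryEquiv.norm_map] at this
  have h3 : RCLike.re (((‖A‖ ^ 2 : ℝ) : ℂ) * ((‖A‖ : ℂ)) ^ 2) = ‖A‖ ^ 2 * ‖A‖ ^ 2 := by
    have : ((‖A‖ ^ 2 : ℝ) : ℂ) * ((‖A‖ : ℂ)) ^ 2 = ((‖A‖ ^ 2 * ‖A‖ ^ 2 : ℝ) : ℂ) := by
      push_cast; ring
    rw [this]; exact Complex.ofReal_re _
  have h4 : ‖((‖A‖ ^ 2 : ℝ) : ℂ)‖ = ‖A‖ ^ 2 := by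
    rw [Complex.norm_real, Real.norm_of_nonneg (by positivity)]
  have h5 := pow_le_pow_left₀ (norm_nonneg _) h2 2
  rw [h4]
  erw [h3]
  nlinarith [h5]

/-- At a vector where the norm of `A` is attained, the numerical value of a generator of Lindblad
form applied to `A` has nonpositive real part. -/
lemma re_inner_lindblad_nonpos {m : ℕ} (H : E →L[ℂ] E) (hH : IsSelfAdjoint H)
    (K : Fin m → E →L[ℂ] E) (A : E →L[ℂ] E) {ψ : E} (h1 : ‖ψ‖ = 1) (hψ : ‖A ψ‖ = ‖A‖) :
    (inner ℂ (A ψ) ((Complex.I • (H * A - A * H) + ∑ j, (star (K j) * A * K j -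
      (1 / 2 : ℂ) • (star (K j) * K j * A + A * (star (K j) * K j)))) ψ)).re ≤ 0 := by
  have hadj : ∀ x : E, inner ℂ (A ψ) (A x) = ((‖A‖ ^ 2 : ℝ) : ℂ) * inner ℂ ψ x := by
    intro x
    rw [← ContinuousLinearMap.adjoint_inner_left, ← ContinuousLinearMap.star_eq_adjoint,
      adjoint_apply_apply_of_norm_attained A h1 hψ, inner_smul_left]
    simp
  have hsym : ∀ x : E, (inner ℂ x (H x)).im = 0 := fun x =>
    (ContinuousLinearMap.isSelfAdjoint_iff_isSymmetric.mp hH).im_inner_self_apply x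
  have hmul : ∀ (S T : E →L[ℂ] E) (x : E), (S * T) x = S (T x) := fun _ _ _ => rfl
  have hterm : ∀ j, (inner ℂ (A ψ) ((star (K j) * A * K j -
      (1 / 2 : ℂ) • (star (K j) * K j * A + A * (star (K j) * K j))) ψ)).re ≤ 0 := by
    intro j
    have e1 : inner ℂ (A ψ) (star (K j) (A (K j ψ))) = inner ℂ (K j (A ψ)) (A (K j ψ)) := by
      rw [ContinuousLinearMap.star_eq_adjoint, ContinuousLinearMap.adjoint_inner_right]
    have e2 : inner ℂ (A ψ) (star (K j) (K j (A ψ))) = ((‖K j (A ψ)‖ ^ 2 : ℝ) : ℂ) := by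
      rw [ContinuousLinearMap.star_eq_adjoint, ContinuousLinearMap.adjoint_inner_right,
        inner_self_eq_norm_sq_to_K]; simp
    have e3 : inner ℂ (A ψ) (A (star (K j) (K j ψ))) =
        ((‖A‖ ^ 2 * ‖K j ψ‖ ^ 2 : ℝ) : ℂ) := by
      rw [hadj, ContinuousLinearMap.star_eq_adjoint, ContinuousLinearMap.adjoint_inner_right,
        inner_self_eq_norm_sq_to_K]; simp
    have e4 : (inner ℂ (K j (A ψ)) (A (K j ψ))).re ≤ ‖K j (A ψ)‖ * (‖A‖ * ‖K j ψ‖) :=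
      ((Complex.re_le_norm _).trans (norm_inner_le_norm _ _)).trans
        (mul_le_mul_of_nonneg_left (A.le_opNorm _) (norm_nonneg _))
    simp only [sub_apply, smul_apply,
      add_apply, hmul, inner_sub_right,
      inner_smul_right, inner_add_right]
    rw [e1, e2, e3, ← Complex.ofReal_add, show (1 / 2 : ℂ) = ((1 / 2 : ℝ) : ℂ) by push_cast; rfl,
      ← Complex.ofReal_mul, Complex.sub_re, Complex.ofReal_re]
    nlinarith [sq_nonneg (‖K j (A ψ)‖ - ‖A‖ * ‖K j ψ‖)]
  rw [add_apply, inner_add_right, Complex.add_re, sum_apply,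
    inner_sum, Complex.re_sum]
  have h0 : (inner ℂ (A ψ) ((Complex.I • (H * A - A * H)) ψ)).re = 0 := by
    simp only [sub_apply, smul_apply,
      hmul, inner_sub_right, inner_smul_right]
    rw [hadj]
    simp [hsym, -Complex.ofReal_pow]
  rw [h0, zero_add]
  exact Finset.sum_nonpos fun j _ => hterm j

end Hilbert

section Exponential

variable {V : Type*} [NormedAddCommGroup V] [NormedSpace ℂ V] [FiniteDimensional ℂ V]

lemma exp_zero_and_hasDerivAt (T : V →ₗ[ℂ] V) (x : V) :
    (∑' n : ℕ, (((0 : ℝ) : ℂ) ^ n / (n.factorial : ℂ)) • (T ^ n) x) = x ∧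
    ∀ t : ℝ, HasDerivAt (fun s : ℝ => ∑' n : ℕ, ((s : ℂ) ^ n / (n.factorial : ℂ)) • (T ^ n) x)
      (T (∑' n : ℕ, ((t : ℂ) ^ n / (n.factorial : ℂ)) • (T ^ n) x)) t := by
  have : CompleteSpace V := FiniteDimensional.complete ℂ V
  set Tc := LinearMap.toContinuousLinearMap T with hTc
  have hpow : ∀ n : ℕ, ∀ y, (T ^ n) y = (Tc ^ n) y := by
    intro n
    induction n with
    | zero => intro y; simp
    | succ n ih => intro y; rw [pow_succ, pow_succ]; simp [ih, Tc]
  have hexp : ∀ t : ℝ, (∑' n : ℕ, ((t : ℂ) ^ n / (n.factorial : ℂ)) • (T ^ n) x) =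
      NormedSpace.exp ((t : ℂ) • Tc) x := by
    intro t
    have hs := (NormedSpace.exp_series_hasSum_exp' (𝕂 := ℂ) ((t : ℂ) • Tc))
    have hs2 := hs.mapL (ContinuousLinearMap.apply ℂ V x)
    refine Eq.trans ?_ hs2.tsum_eq
    congr 1
    funext n
    rw [ContinuousLinearMap.apply_apply, smul_apply, smul_pow, smul_apply, smul_smul, hpow]
    congr 1
    ring
  constructor
  · rw [hexp]; simp
  · intro t
    have h := (hasDerivAt_exp_smul_const' (𝕂 := ℂ) Tc (t : ℂ)).scomp t
      Complex.ofRealCLM.hasDerivAt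
    simp only [Complex.ofRealCLM_apply, Complex.ofReal_one, one_smul] at h
    have h2 := ((ContinuousLinearMap.apply ℂ V x).restrictScalars
      ℝ).hasFDerivAt.comp_hasDerivAt t h
    simp only [hexp]
    exact h2

end Exponential

section Lindblad

variable {ι : Type} [Fintype ι]

lemma IsLindblad.add {S T : SuperOp ι} (hS : IsLindblad S) (hT : IsLindblad T) :
    IsLindblad (S + T) := by
  obtain ⟨H, hH, m, K, hK⟩ := hS
  obtain ⟨H', hH', m', K', hK'⟩ := hT
  refine ⟨H + H', hH.add hH', m + m', Fin.append K K', fun A => ?_⟩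
  rw [LinearMap.add_apply, hK, hK', Fin.sum_univ_add]
  simp only [Fin.append_left, Fin.append_right, add_mul, mul_add, smul_sub, smul_add]
  abel

lemma IsLindblad.zero : IsLindblad (0 : SuperOp ι) :=
  ⟨0, Matrix.isHermitian_zero, 0, Fin.elim0, fun A => by simp⟩

lemma IsLindblad.sum {α : Type*} (s : Finset α) (T : α → SuperOp ι)
    (h : ∀ a ∈ s, IsLindblad (T a)) : IsLindblad (∑ a ∈ s, T a) :=
  Finset.sum_induction _ _ (fun _ _ => IsLindblad.add) IsLindblad.zero h

variable [DecidableEq ι]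

lemma IsLindblad.map_one {T : SuperOp ι} (hT : IsLindblad T) : T 1 = 0 := by
  obtain ⟨H, hH, m, K, hK⟩ := hT
  rw [hK]
  simp [← two_smul ℂ, smul_smul]

lemma IsLindblad.dissipative {T : SuperOp ι} (hT : IsLindblad T) : Dissipative T := by
  obtain ⟨H, hH, m, K, hK⟩ := hT
  intro h hh A
  let φ := Matrix.toEuclideanCLM (n := ι) (𝕜 := ℂ)
  by_cases hA : A = 0
  · simp [hA]
  have hφA : φ A ≠ 0 := by simpa using hA
  obtain ⟨ψ, h1, hψ⟩ := exists_unit_norm_apply_eq_opNorm (φ A) hφA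
  have hHs : IsSelfAdjoint (φ H) := by
    have : IsSelfAdjoint H := hH
    exact this.map φ
  have key := re_inner_lindblad_nonpos (φ H) hHs (fun j => φ (K j)) (φ A) h1 hψ
  have hTA : φ (T A) = Complex.I • (φ H * φ A - φ A * φ H) +
      ∑ j, (star (φ (K j)) * φ A * φ (K j) -
      (1 / 2 : ℂ) • (star (φ (K j)) * φ (K j) * φ A + φ A * (star (φ (K j)) * φ (K j)))) := by
    rw [hK]
    simp only [map_add, map_smul, map_sub, map_mul, map_sum, ← Matrix.star_eq_conjTranspose,
      map_star]
  rw [← hTA] at key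
  have hpos : 0 < ‖φ A‖ := norm_pos_iff.mpr hφA
  change ‖φ A‖ ≤ ‖φ (A - h • T A)‖
  have e : (inner ℂ (φ A ψ) (φ (A - h • T A) ψ)).re =
      ‖φ A‖ ^ 2 - h * (inner ℂ (φ A ψ) (φ (T A) ψ)).re := by
    have : φ (A - h • T A) = φ A - (h : ℂ) • φ (T A) := by
      rw [map_sub, ← Complex.coe_smul, map_smul]
    rw [this, sub_apply, inner_sub_right, smul_apply,
      inner_smul_right, inner_self_eq_norm_sq_to_K, hψ]
    simp [← Complex.ofReal_pow]
  have le : (inner ℂ (φ A ψ) (φ (A - h • T A) ψ)).re ≤ ‖φ A‖ * ‖φ (A - h • T A)‖ := by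
    refine ((Complex.re_le_norm _).trans (norm_inner_le_norm _ _)).trans ?_
    rw [hψ]
    refine mul_le_mul_of_nonneg_left ?_ (norm_nonneg _)
    simpa [h1] using (φ (A - h • T A)).le_opNorm ψ
  rw [e] at le
  have : ‖φ A‖ * ‖φ A‖ ≤ ‖φ A‖ * ‖φ (A - h • T A)‖ := by
    nlinarith [mul_nonneg hh (neg_nonneg.mpr key)]
  exact le_of_mul_le_mul_left this hpos

lemma evolve_zero (T : SuperOp ι) (A : Matrix ι ι ℂ) : evolve T 0 A = A := by
  have h := (exp_zero_and_hasDerivAt T A).1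
  exact h

lemma hasDerivAt_evolve (T : SuperOp ι) (A : Matrix ι ι ℂ) (t : ℝ) :
    HasDerivAt (fun s => evolve T s A) (T (evolve T t A)) t :=
  (exp_zero_and_hasDerivAt T A).2 t

end Lindblad

section DissipativeFlow

variable {V : Type*} [NormedAddCommGroup V] [NormedSpace ℂ V] [FiniteDimensional ℂ V]

/-- An inhomogeneous dissipative linear equation is controlled by the size of its source term. -/
lemma Dissipative.norm_le {T : V →ₗ[ℂ] V} (hT : Dissipative T) {y b : ℝ → V}
    (hy : ∀ t, HasDerivAt y (T (y t) + b t) t) {B β : ℝ → ℝ} (hB : ∀ t, HasDerivAt B (β t) t)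
    (hb : ∀ t, 0 ≤ t → ‖b t‖ ≤ β t) (h0 : ‖y 0‖ ≤ B 0) {t : ℝ} (ht : 0 ≤ t) : ‖y t‖ ≤ B t := by
  have hcont : Continuous y := continuous_iff_continuousAt.mpr fun t => (hy t).continuousAt
  refine image_le_of_liminf_slope_right_le_deriv_boundary (f := fun t => ‖y t‖) (a := 0) (b := t)
    (B := B) (B' := β) hcont.norm.continuousOn h0
    (fun s _ => (hB s).continuousAt.continuousWithinAt)
    (fun s _ => (hB s).hasDerivWithinAt) ?_ ⟨ht, le_rfl⟩
  intro s hs r hr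
  refine Filter.Eventually.frequently ?_
  -- the difference quotient is bounded by the norm of `slope y s z - T (y z)`
  have hlim : Filter.Tendsto (fun z => ‖slope y s z - T (y z)‖) (𝓝[>] s) (𝓝 ‖b s‖) := by
    have h1 : Filter.Tendsto (slope y s) (𝓝[>] s) (𝓝 (T (y s) + b s)) :=
      (hasDerivAt_iff_tendsto_slope.mp (hy s)).mono_left
        (nhdsWithin_mono _ fun z (hz : s < z) => hz.ne')
    have h2 : Filter.Tendsto (fun z => T (y z)) (𝓝[>] s) (𝓝 (T (y s))) :=
      ((T.continuous_of_finiteDimensional.comp hcont).tendsto s).mono_left nhdsWithin_le_nhds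
    simpa using (h1.sub h2).norm
  filter_upwards [hlim.eventually_lt_const ((hb s hs.1).trans_lt hr), self_mem_nhdsWithin]
    with z hz hsz
  have hsz : 0 < z - s := sub_pos.mpr hsz
  refine lt_of_le_of_lt ?_ hz
  have h3 := hT (z - s) hsz.le (y z)
  have h4 : y z - (z - s) • T (y z) = y s + (z - s) • (slope y s z - T (y z)) := by
    rw [smul_sub, slope_def_module, smul_inv_smul₀ hsz.ne']
    abel
  rw [h4] at h3
  have h5 := h3.trans (norm_add_le _ _)
  rw [norm_smul, Real.norm_of_nonneg hsz.le] at h5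
  rw [slope_def_field, div_le_iff₀ hsz]
  linarith

lemma Dissipative.norm_le_integral {T : V →ₗ[ℂ] V} (hT : Dissipative T) {y b : ℝ → V}
    (hy : ∀ t, HasDerivAt y (T (y t) + b t) t) {β : ℝ → ℝ} (hβ : Continuous β)
    (hb : ∀ t, 0 ≤ t → ‖b t‖ ≤ β t) {t : ℝ} (ht : 0 ≤ t) :
    ‖y t‖ ≤ ‖y 0‖ + ∫ s in (0 : ℝ)..t, β s :=
  hT.norm_le hy (B := fun t => ‖y 0‖ + ∫ s in (0 : ℝ)..t, β s)
    (fun t => (hβ.integral_hasStrictDerivAt 0 t).hasDerivAt.const_add _) hb (by simp) ht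

lemma integral_gronwall {G : ℝ → ℝ} (hG : Continuous G) {a M : ℝ}
    (h : ∀ t, 0 ≤ t → G t ≤ a + M * ∫ s in (0 : ℝ)..t, G s) (hM : 0 ≤ M) {t : ℝ} (ht : 0 ≤ t) :
    a + M * (∫ s in (0 : ℝ)..t, G s) ≤ a * Real.exp (M * t) := by
  have hd : ∀ t, HasDerivAt (fun t => a + M * ∫ s in (0 : ℝ)..t, G s) (M * G t) t := fun t =>
    ((hG.integral_hasStrictDerivAt 0 t).hasDerivAt.const_mul M).const_add a
  have := le_gronwallBound_of_liminf_deriv_right_le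
    (f := fun t => a + M * ∫ s in (0 : ℝ)..t, G s) (f' := fun t => M * G t) (δ := a) (K := M)
    (ε := 0) (a := 0) (b := t) (fun s _ => (hd s).continuousAt.continuousWithinAt)
    (fun s _ r hr => by
      have := (hd s).hasDerivWithinAt (s := Set.Ici s)
      have := this.liminf_right_slope_le hr
      simpa [slope_def_field, div_eq_inv_mul] using this)
    (by simp) (fun s hs => by
      have := mul_le_mul_of_nonneg_left (h s hs.1) hM
      simpa using this) t ⟨ht, le_rfl⟩
  simpa [gronwallBound_ε0] using this

variable {Λ : Type*} [Fintype Λ] [DecidableEq Λ] {L : Λ → V →ₗ[ℂ] V}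

lemma HasDerivAt.linearMap_apply {y : ℝ → V} {y' : V} {t : ℝ} (hy : HasDerivAt y y' t)
    (K : V →ₗ[ℂ] V) : HasDerivAt (fun s => K (y s)) (K y') t :=
  ((LinearMap.toContinuousLinearMap K).restrictScalars ℝ).hasFDerivAt.comp_hasDerivAt t hy

/-- Propagation estimate: the growth of `‖K y‖` along the flow is only due to those generators
which do not commute with `K`. -/
lemma norm_apply_flow_le (hL : ∀ s : Finset Λ, Dissipative (∑ v ∈ s, L v)) {y : ℝ → V}
    (hy : ∀ t, HasDerivAt y ((∑ v, L v) (y t)) t) {K : V →ₗ[ℂ] V} {κ : ℝ}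
    (hK : ∀ x, ‖K x‖ ≤ κ * ‖x‖) {S : Finset Λ} (hS : ∀ v, v ∉ S → ∀ x, K (L v x) = L v (K x))
    {t : ℝ} (ht : 0 ≤ t) :
    ‖K (y t)‖ ≤ ‖K (y 0)‖ + κ * ∑ v ∈ S, ∫ s in (0 : ℝ)..t, ‖L v (y s)‖ := by
  have hc : Continuous y := continuous_iff_continuousAt.mpr fun t => (hy t).continuousAt
  have hcL : ∀ v, Continuous fun s => ‖L v (y s)‖ := fun v =>
    ((L v).continuous_of_finiteDimensional.comp hc).norm
  have hder : ∀ t, HasDerivAt (fun s => K (y s))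
      ((∑ v ∈ Sᶜ, L v) (K (y t)) + K ((∑ v ∈ S, L v) (y t))) t := by
    intro t
    refine ((hy t).linearMap_apply K).congr_deriv ?_
    rw [← Finset.sum_compl_add_sum S, LinearMap.add_apply, map_add, LinearMap.sum_apply,
      LinearMap.sum_apply, LinearMap.sum_apply, map_sum]
    congr 1
    exact Finset.sum_congr rfl fun v hv => hS v (Finset.mem_compl.mp hv) _
  have hκ : ∀ x : V, 0 ≤ κ * ‖x‖ := fun x => (norm_nonneg _).trans (hK x)
  have := (hL Sᶜ).norm_le_integral hder (β := fun s => κ * ∑ v ∈ S, ‖L v (y s)‖)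
    (continuous_const.mul (continuous_finsetSum _ fun v _ => hcL v)) (fun s _ => by
      refine (hK _).trans ?_
      by_cases h0 : 0 ≤ κ
      · refine mul_le_mul_of_nonneg_left ?_ h0
        rw [LinearMap.sum_apply]
        exact norm_sum_le _ _
      · have hz : ∀ x : V, ‖x‖ = 0 := fun x => by
          by_contra hx
          have hx : 0 < ‖x‖ := lt_of_le_of_ne (norm_nonneg _) (Ne.symm hx)
          nlinarith [hκ x]
        simp [hz]) ht
  rwa [intervalIntegral.integral_const_mul,
    intervalIntegral.integral_finsetSum fun v _ => (hcL v).intervalIntegrable _ _] at this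

/-- Weighted propagation estimate for a family of operators. -/
lemma weighted_sum_norm_apply_flow_le (hL : ∀ s : Finset Λ, Dissipative (∑ v ∈ s, L v))
    {y : ℝ → V} (hy : ∀ t, HasDerivAt y ((∑ v, L v) (y t)) t) {K : Λ → V →ₗ[ℂ] V} {κ : ℝ}
    (hκ : 0 ≤ κ) (hK : ∀ u x, ‖K u x‖ ≤ κ * ‖x‖) {S : Λ → Finset Λ}
    (hS : ∀ u v, v ∉ S u → ∀ x, K u (L v x) = L v (K u x)) {w : Λ → ℝ} (hw : ∀ u, 0 ≤ w u) {M : ℝ}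
    (hM : ∀ v, ∑ u with v ∈ S u, w u ≤ M * w v) {t : ℝ} (ht : 0 ≤ t) :
    ∑ u, w u * ‖K u (y t)‖ ≤
      ∑ u, w u * ‖K u (y 0)‖ + κ * (M * ∫ s in (0 : ℝ)..t, ∑ v, w v * ‖L v (y s)‖) := by
  have hc : Continuous y := continuous_iff_continuousAt.mpr fun t => (hy t).continuousAt
  have hcL : ∀ v, Continuous fun s => ‖L v (y s)‖ := fun v =>
    ((L v).continuous_of_finiteDimensional.comp hc).norm
  calc ∑ u, w u * ‖K u (y t)‖
      ≤ ∑ u, w u * (‖K u (y 0)‖ + κ * ∑ v ∈ S u, ∫ s in (0 : ℝ)..t, ‖L v (y s)‖) :=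
        Finset.sum_le_sum fun u _ => mul_le_mul_of_nonneg_left
          (norm_apply_flow_le hL hy (hK u) (hS u) ht) (hw u)
    _ = ∑ u, w u * ‖K u (y 0)‖ +
          κ * ∑ v, (∑ u with v ∈ S u, w u) * ∫ s in (0 : ℝ)..t, ‖L v (y s)‖ := by
        simp only [mul_add, Finset.sum_add_distrib, Finset.mul_sum, Finset.sum_mul,
          Finset.sum_filter]
        congr 1
        rw [Finset.sum_comm' (t' := Finset.univ) (s' := fun v => {u | v ∈ S u}) (by simp)]
        refine Finset.sum_congr rfl fun v _ => ?_
        rw [Finset.sum_filter]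
        refine Finset.sum_congr rfl fun u _ => ?_
        split_ifs <;> ring
    _ ≤ ∑ u, w u * ‖K u (y 0)‖ + κ * ∑ v, M * w v * ∫ s in (0 : ℝ)..t, ‖L v (y s)‖ := by
        gcongr with v hv
        · exact intervalIntegral.integral_nonneg ht fun s _ => norm_nonneg _
        · exact hM v
    _ = _ := by
        rw [intervalIntegral.integral_finsetSum fun v _ =>
          ((hcL v).const_mul (w v)).intervalIntegrable _ _]
        simp only [intervalIntegral.integral_const_mul, Finset.mul_sum, mul_assoc]

/-- Lieb–Robinson bound in weighted form, for the generators themselves and for a family `K` of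
operators with the same commutation structure. -/
lemma lieb_robinson (hL : ∀ s : Finset Λ, Dissipative (∑ v ∈ s, L v))
    {y : ℝ → V} (hy : ∀ t, HasDerivAt y ((∑ v, L v) (y t)) t) (hL1 : ∀ u x, ‖L u x‖ ≤ ‖x‖)
    {K : Λ → V →ₗ[ℂ] V} {κ : ℝ}
    (hκ : 0 ≤ κ) (hK : ∀ u x, ‖K u x‖ ≤ κ * ‖x‖) {S : Λ → Finset Λ}
    (hS : ∀ u v, v ∉ S u → ∀ x, K u (L v x) = L v (K u x))
    (hSL : ∀ u v, v ∉ S u → ∀ x, L u (L v x) = L v (L u x))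
    {w : Λ → ℝ} (hw : ∀ u, 0 ≤ w u) {M : ℝ} (hM0 : 0 ≤ M)
    (hM : ∀ v, ∑ u with v ∈ S u, w u ≤ M * w v) {a : ℝ}
    (hLa : ∑ u, w u * ‖L u (y 0)‖ ≤ a) (hKa : ∑ u, w u * ‖K u (y 0)‖ ≤ κ * a)
    {t : ℝ} (ht : 0 ≤ t) :
    ∑ u, w u * ‖L u (y t)‖ ≤ a * Real.exp (M * t) ∧
      ∑ u, w u * ‖K u (y t)‖ ≤ κ * (a * Real.exp (M * t)) := by
  have hc : Continuous y := continuous_iff_continuousAt.mpr fun t => (hy t).continuousAt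
  have hcL : ∀ v, Continuous fun s => ‖L v (y s)‖ := fun v =>
    ((L v).continuous_of_finiteDimensional.comp hc).norm
  have hstep : ∀ t, 0 ≤ t → ∑ u, w u * ‖L u (y t)‖ ≤
      a + M * ∫ s in (0 : ℝ)..t, ∑ v, w v * ‖L v (y s)‖ := fun t ht => by
    have := weighted_sum_norm_apply_flow_le hL hy zero_le_one
      (fun u x => by simpa using hL1 u x) hSL hw hM ht
    rw [one_mul] at this
    linarith
  have hG := integral_gronwall (continuous_finsetSum _ fun v _ => (hcL v).const_mul (w v)) hstep
    hM0 ht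
  refine ⟨(hstep t ht).trans hG, ?_⟩
  refine (weighted_sum_norm_apply_flow_le hL hy hκ hK hS hw hM ht).trans ?_
  calc _ ≤ κ * a + κ * (M * ∫ s in (0 : ℝ)..t, ∑ v, w v * ‖L v (y s)‖) := by gcongr
    _ = κ * (a + M * ∫ s in (0 : ℝ)..t, ∑ v, w v * ‖L v (y s)‖) := by ring
    _ ≤ _ := mul_le_mul_of_nonneg_left hG hκ

/-- Truncating the generator to the sites in `I` changes the flow little when the weights are large
outside `I`. -/
lemma norm_flow_sub_truncated_le {y z : ℝ → V} (hy : ∀ t, HasDerivAt y ((∑ v, L v) (y t)) t)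
    {I : Finset Λ} (hI : Dissipative (∑ v ∈ I, L v))
    (hz : ∀ t, HasDerivAt z ((∑ v ∈ I, L v) (z t)) t) (h0 : y 0 = z 0)
    {w : Λ → ℝ} (hw : ∀ u, 0 ≤ w u) {M a W : ℝ} (hM : 1 ≤ M) (ha : 0 ≤ a) (hW : 0 < W)
    (hWw : ∀ u, u ∉ I → W ≤ w u)
    (hLR : ∀ t, 0 ≤ t → ∑ u, w u * ‖L u (y t)‖ ≤ a * Real.exp (M * t)) {t : ℝ} (ht : 0 ≤ t) :
    ‖y t - z t‖ ≤ W⁻¹ * a * Real.exp (M * t) := by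
  have hder : ∀ t, HasDerivAt (fun s => y s - z s)
      ((∑ v ∈ I, L v) (y t - z t) + (∑ v ∈ Iᶜ, L v) (y t)) t := fun t => by
    refine ((hy t).sub (hz t)).congr_deriv ?_
    rw [← Finset.sum_add_sum_compl I, LinearMap.add_apply, map_sub]
    abel
  have hM' : 0 < M := by linarith
  have hB : ∀ t, HasDerivAt (fun s => W⁻¹ * a * Real.exp (M * s) / M)
      (W⁻¹ * a * Real.exp (M * t)) t := fun t => by
    have := ((((hasDerivAt_id t).const_mul M).exp).const_mul (W⁻¹ * a)).div_const M
    refine this.congr_deriv ?_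
    field_simp
    simp
  refine (hI.norm_le hder hB (fun s hs => ?_) ?_ ht).trans
    (div_le_self (by positivity) hM)
  · rw [LinearMap.sum_apply]
    refine (norm_sum_le _ _).trans ?_
    rw [mul_assoc, ← div_eq_inv_mul, le_div_iff₀ hW, mul_comm, Finset.mul_sum]
    refine le_trans ?_ (hLR s hs)
    refine (Finset.sum_le_sum fun u hu => ?_).trans
      (Finset.sum_le_sum_of_subset_of_nonneg (Finset.subset_univ Iᶜ) fun u _ _ =>
        mul_nonneg (hw u) (norm_nonneg _))
    exact mul_le_mul_of_nonneg_right (hWw u (Finset.mem_compl.mp hu)) (norm_nonneg _)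
  · simp only [h0, sub_self, norm_zero]
    positivity

end DissipativeFlow

section Reindexing

variable {m n : Type*} [Fintype m] [Fintype n] [DecidableEq m] [DecidableEq n]

lemma Matrix.l2_opNorm_submatrix_equiv (e : m ≃ n) (M : Matrix n n ℂ) :
    ‖M.submatrix e e‖ = ‖M‖ := by
  let φ : Matrix n n ℂ →⋆ₙₐ[ℂ] Matrix m m ℂ :=
    { toFun := fun M => M.submatrix e e
      map_smul' := fun _ _ => rfl
      map_zero' := rfl
      map_add' := fun _ _ => rfl
      map_mul' := fun A B => (Matrix.submatrix_mul_equiv A B e e e).symm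
      map_star' := fun _ => rfl }
  refine NonUnitalStarAlgHom.norm_map φ (fun A B h => ?_) M
  ext i j
  have hij : A.submatrix e e (e.symm i) (e.symm j) = B.submatrix e e (e.symm i) (e.symm j) :=
    congrFun (congrFun h _) _
  simpa using hij

end Reindexing

section CompletelyBounded

variable {ι : Type} [Fintype ι] [DecidableEq ι] {T : SuperOp ι} {κ : ℝ}

lemma norm_ampliation_le (hκ : 0 ≤ κ) (hT : cbNorm T ≤ ENNReal.ofReal κ) (n : ℕ)
    (M : Matrix (ι × Fin n) (ι × Fin n) ℂ) : ‖ampliation T n M‖ ≤ κ * ‖M‖ := by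
  by_cases hM : M = 0
  · simp [hM]
  have hM' : 0 < ‖M‖ := norm_pos_iff.mpr hM
  have h1 : ENNReal.ofReal ‖ampliation T n (((‖M‖⁻¹ : ℝ) : ℂ) • M)‖ ≤ ENNReal.ofReal κ := by
    refine le_trans ?_ hT
    refine le_iSup_of_le n (le_iSup_of_le _ (le_iSup_of_le ?_ le_rfl))
    rw [norm_smul, Complex.norm_real, norm_inv, norm_norm, inv_mul_cancel₀ hM'.ne']
  rw [ENNReal.ofReal_le_ofReal_iff hκ, map_smul, norm_smul, Complex.norm_real, norm_inv, norm_norm,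
    inv_mul_le_iff₀ hM', mul_comm] at h1
  exact h1

lemma norm_superOp_le (hκ : 0 ≤ κ) (hT : cbNorm T ≤ ENNReal.ofReal κ) (M : Matrix ι ι ℂ) :
    ‖T M‖ ≤ κ * ‖M‖ := by
  have h := norm_ampliation_le hκ hT 1
    (M.submatrix (Equiv.prodUnique ι (Fin 1)) (Equiv.prodUnique ι (Fin 1)))
  rw [Matrix.l2_opNorm_submatrix_equiv] at h
  refine le_of_eq_of_le ?_ h
  rw [← Matrix.l2_opNorm_submatrix_equiv (Equiv.prodUnique ι (Fin 1))]
  rfl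

end CompletelyBounded

section Embedding

variable {R S Λ : Type} {q : ℕ}

lemma extend_comp_of_disjoint {f : S → Λ} {g : R → Λ} (h : Disjoint (Set.range f) (Set.range g))
    (s : S → Fin q) (σ : Λ → Fin q) : Function.extend f s σ ∘ g = σ ∘ g := by
  funext x
  refine Function.extend_apply' _ _ _ ?_
  rintro ⟨a, ha⟩
  exact Set.disjoint_left.mp h ⟨a, ha⟩ ⟨x, rfl⟩

lemma extend_comp_self (f : S → Λ) (σ : Λ → Fin q) :
    Function.extend f (σ ∘ f) σ = σ := by
  classical
  funext x
  by_cases hx : ∃ a, f a = x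
  · rw [Function.extend_def, dif_pos hx, Function.comp_apply, Classical.choose_spec hx]
  · exact Function.extend_apply' _ _ _ hx

lemma extend_extend (f : S → Λ) (s t : S → Fin q) (σ : Λ → Fin q) :
    Function.extend f s (Function.extend f t σ) = Function.extend f s σ := by
  classical
  funext x
  by_cases hx : ∃ a, f a = x
  · simp only [Function.extend_def, dif_pos hx]
  · simp only [Function.extend_apply' _ _ _ hx]

lemma extend_extend_comm {f : S → Λ} {g : R → Λ} (h : Disjoint (Set.range f) (Set.range g))
    (s : S → Fin q) (t : R → Fin q) (σ : Λ → Fin q) :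
    Function.extend f s (Function.extend g t σ) = Function.extend g t (Function.extend f s σ) := by
  classical
  funext x
  by_cases hx : ∃ a, f a = x
  · have hx' : ¬ ∃ b, g b = x := fun hb => Set.disjoint_left.mp h hx hb
    rw [Function.extend_apply' t (Function.extend f s σ) x hx']
    simp only [Function.extend_def, dif_pos hx]
  · rw [Function.extend_apply' s (Function.extend g t σ) x hx]
    by_cases hx' : ∃ a, g a = x
    · simp only [Function.extend_def, dif_pos hx']
    · simp only [Function.extend_apply' _ _ _ hx', Function.extend_apply' _ _ _ hx]

/-- The operator on the sites `f(S)` obtained by fixing the configurations on all other sites. -/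
noncomputable def slice (f : S → Λ) (σ τ : Λ → Fin q) :
    Matrix (Λ → Fin q) (Λ → Fin q) ℂ →ₗ[ℂ] Matrix (S → Fin q) (S → Fin q) ℂ where
  toFun A := Matrix.of fun s s' => A (Function.extend f s σ) (Function.extend f s' τ)
  map_add' _ _ := rfl
  map_smul' _ _ := rfl

lemma slice_apply (f : S → Λ) (σ τ : Λ → Fin q) (A : Matrix (Λ → Fin q) (Λ → Fin q) ℂ)
    (s s' : S → Fin q) :
    slice f σ τ A s s' = A (Function.extend f s σ) (Function.extend f s' τ) := rfl

lemma embedSuper_apply (f : S → Λ) (T : SuperOp (S → Fin q))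
    (A : Matrix (Λ → Fin q) (Λ → Fin q) ℂ) (σ τ : Λ → Fin q) :
    embedSuper f T A σ τ = T (slice f σ τ A) (σ ∘ f) (τ ∘ f) := rfl

lemma slice_apply_comp (f : S → Λ) (σ τ : Λ → Fin q) (A : Matrix (Λ → Fin q) (Λ → Fin q) ℂ) :
    slice f σ τ A (σ ∘ f) (τ ∘ f) = A σ τ := by
  rw [slice_apply, extend_comp_self, extend_comp_self]

open Classical in
lemma embedObs_apply (f : S → Λ) (B : Matrix (S → Fin q) (S → Fin q) ℂ) (σ τ : Λ → Fin q) :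
    embedObs f B σ τ = if ∀ x, x ∉ Set.range f → σ x = τ x then B (σ ∘ f) (τ ∘ f) else 0 := rfl

lemma slice_embedObs_self {f : S → Λ} (hf : Function.Injective f) (σ : Λ → Fin q)
    (B : Matrix (S → Fin q) (S → Fin q) ℂ) : slice f σ σ (embedObs f B) = B := by
  ext s s'
  rw [slice_apply, embedObs_apply, if_pos, Function.extend_comp hf, Function.extend_comp hf]
  intro x hx
  rw [Function.extend_apply' _ _ _ hx, Function.extend_apply' _ _ _ hx]

lemma embedObs_conjTranspose (f : S → Λ) (B : Matrix (S → Fin q) (S → Fin q) ℂ) :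
    (embedObs f B).conjTranspose = embedObs f B.conjTranspose := by
  ext σ τ
  have hiff : (∀ x, x ∉ Set.range f → τ x = σ x) ↔ ∀ x, x ∉ Set.range f → σ x = τ x :=
    forall₂_congr fun _ _ => eq_comm
  rw [Matrix.conjTranspose_apply, embedObs_apply, embedObs_apply]
  by_cases h : ∀ x, x ∉ Set.range f → σ x = τ x
  · rw [if_pos h, if_pos (hiff.mpr h), Matrix.conjTranspose_apply]
  · rw [if_neg h, if_neg (mt hiff.mp h), star_zero]

/-- `T ⊗ id` annihilates the operators supported away from the sites of `T` if it annihilates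
the identity. -/
lemma embedSuper_embedObs_of_disjoint [Fintype S] [Fintype Λ] [DecidableEq S] [DecidableEq Λ]
    {f : S → Λ} {g : R → Λ} (hf : Function.Injective f)
    (h : Disjoint (Set.range f) (Set.range g)) {T : SuperOp (S → Fin q)}
    (hT : embedSuper f T 1 = 0) (B : Matrix (R → Fin q) (R → Fin q) ℂ) :
    embedSuper f T (embedObs g B) = 0 := by
  classical
  have hone : ∀ σ τ : Λ → Fin q, T 1 (σ ∘ f) (τ ∘ f) = 0 := by
    intro σ τ
    have := congrFun (congrFun hT σ) (Function.extend f (τ ∘ f) σ)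
    rw [embedSuper_apply, Function.extend_comp hf] at this
    convert this using 3
    ext s s'
    rw [slice_apply, extend_extend]
    by_cases hs : s = s'
    · rw [hs, Matrix.one_apply_eq, Matrix.one_apply_eq]
    · rw [Matrix.one_apply_ne hs, Matrix.one_apply_ne fun he => hs ?_]
      rw [← Function.extend_comp hf s σ, he, Function.extend_comp hf]
    rfl
  ext σ τ
  rw [embedSuper_apply]
  have : slice f σ τ (embedObs g B) =
      (if ∀ x, x ∉ Set.range f → x ∉ Set.range g → σ x = τ x then B (σ ∘ g) (τ ∘ g) else 0) •
        (1 : Matrix (S → Fin q) (S → Fin q) ℂ) := by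
    ext s s'
    rw [slice_apply, embedObs_apply, extend_comp_of_disjoint h, extend_comp_of_disjoint h,
      Matrix.smul_apply, Matrix.one_apply]
    have hiff : (∀ x, x ∉ Set.range g → Function.extend f s σ x = Function.extend f s' τ x) ↔
        (s = s' ∧ ∀ x, x ∉ Set.range f → x ∉ Set.range g → σ x = τ x) := by
      constructor
      · intro hx
        constructor
        · funext a
          have := hx (f a) (Set.disjoint_left.mp h ⟨a, rfl⟩)
          rwa [hf.extend_apply, hf.extend_apply] at this
        · intro x hxf hxg
          have := hx x hxg
          rwa [Function.extend_apply' _ _ _ hxf, Function.extend_apply' _ _ _ hxf] at this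
      · rintro ⟨rfl, hx⟩ x hxg
        by_cases hxf : x ∈ Set.range f
        · obtain ⟨a, rfl⟩ := hxf
          rw [hf.extend_apply, hf.extend_apply]
        · rw [Function.extend_apply' _ _ _ hxf, Function.extend_apply' _ _ _ hxf]
          exact hx x hxf hxg
    simp only [hiff]
    by_cases h1 : s = s' <;> simp [h1]
  rw [this, map_smul, Matrix.smul_apply, hone, smul_zero, Matrix.zero_apply]

lemma superOp_apply_eq_sum {ι : Type} [Fintype ι] [DecidableEq ι] (T : SuperOp ι)
    (M : Matrix ι ι ℂ) (i j : ι) :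
    T M i j = ∑ k, ∑ l, M k l * T (Matrix.single k l 1) i j := by
  conv_lhs => rw [Matrix.matrix_eq_sum_single M]
  simp only [map_sum, Matrix.sum_apply]
  refine Finset.sum_congr rfl fun k _ => Finset.sum_congr rfl fun l _ => ?_
  rw [← mul_one (M k l), ← smul_eq_mul, ← Matrix.smul_single, map_smul]
  simp

lemma sum_sum_comm {α β : Type*} [Fintype α] [Fintype β] (F : α → α → β → β → ℂ) :
    ∑ k, ∑ l, ∑ i, ∑ j, F k l i j = ∑ i, ∑ j, ∑ k, ∑ l, F k l i j := by
  calc _ = ∑ k, ∑ i, ∑ l, ∑ j, F k l i j := Finset.sum_congr rfl fun k _ => Finset.sum_comm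
    _ = ∑ i, ∑ k, ∑ l, ∑ j, F k l i j := Finset.sum_comm
    _ = ∑ i, ∑ k, ∑ j, ∑ l, F k l i j :=
      Finset.sum_congr rfl fun i _ => Finset.sum_congr rfl fun k _ => Finset.sum_comm
    _ = _ := Finset.sum_congr rfl fun i _ => Finset.sum_comm

lemma embedSuper_comm [Fintype S] [Fintype R] [DecidableEq S] [DecidableEq R]
    {f : S → Λ} {g : R → Λ} (h : Disjoint (Set.range f) (Set.range g)) (T : SuperOp (S → Fin q))
    (T' : SuperOp (R → Fin q)) (A : Matrix (Λ → Fin q) (Λ → Fin q) ℂ) :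
    embedSuper f T (embedSuper g T' A) = embedSuper g T' (embedSuper f T A) := by
  ext σ τ
  rw [embedSuper_apply, embedSuper_apply, superOp_apply_eq_sum T, superOp_apply_eq_sum T']
  simp only [slice_apply, embedSuper_apply, extend_comp_of_disjoint h,
    extend_comp_of_disjoint h.symm]
  simp only [superOp_apply_eq_sum T (slice f _ _ _), superOp_apply_eq_sum T' (slice g _ _ _),
    slice_apply, Finset.sum_mul, extend_extend_comm h]
  rw [sum_sum_comm]
  refine Finset.sum_congr rfl fun _ _ => Finset.sum_congr rfl fun _ _ => Finset.sum_congr rfl fun _ _ => Finset.sum_congr rfl fun _ _ => ?_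
  ring

/-- Functoriality: a superoperator on a subsystem, applied to an operator on that subsystem. -/
lemma embedSuper_comp_embedObs {f : S → Λ} {g : R → S} (hf : Function.Injective f)
    (T : SuperOp (R → Fin q)) (B : Matrix (S → Fin q) (S → Fin q) ℂ) :
    embedSuper (f ∘ g) T (embedObs f B) = embedObs f (embedSuper g T B) := by
  classical
  ext σ τ
  rw [embedSuper_apply, embedObs_apply, embedSuper_apply]
  have hcomp : ∀ (s : R → Fin q) (σ : Λ → Fin q),
      Function.extend (f ∘ g) s σ ∘ f = Function.extend g s (σ ∘ f) := by
    intro s σ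
    funext x
    by_cases hx : ∃ a, g a = x
    · have hx' : ∃ a, (f ∘ g) a = f x := hx.imp fun a ha => congrArg f ha
      rw [Function.comp_apply, Function.extend_def, dif_pos hx', Function.extend_def, dif_pos hx]
      have hiff : ∀ a, (f ∘ g) a = f x ↔ g a = x := fun a => hf.eq_iff
      simp only [hiff]
    · have hx' : ¬ ∃ a, (f ∘ g) a = f x := fun ⟨a, ha⟩ => hx ⟨a, hf ha⟩
      rw [Function.comp_apply, Function.extend_apply' _ _ _ hx', Function.extend_apply' _ _ _ hx]
      rfl
  have hout : ∀ (s : R → Fin q) (σ : Λ → Fin q) x, x ∉ Set.range f →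
      Function.extend (f ∘ g) s σ x = σ x := fun s σ x hx =>
    Function.extend_apply' _ _ _ fun ⟨a, ha⟩ => hx ⟨g a, ha⟩
  have : slice (f ∘ g) σ τ (embedObs f B) =
      (if ∀ x, x ∉ Set.range f → σ x = τ x then (1 : ℂ) else 0) •
        slice g (σ ∘ f) (τ ∘ f) B := by
    ext s s'
    rw [slice_apply, embedObs_apply, hcomp, hcomp, Matrix.smul_apply, slice_apply]
    have hiff : (∀ x, x ∉ Set.range f →
        Function.extend (f ∘ g) s σ x = Function.extend (f ∘ g) s' τ x) ↔
        ∀ x, x ∉ Set.range f → σ x = τ x :=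
      forall₂_congr fun x hx => by rw [hout _ _ _ hx, hout _ _ _ hx]
    simp only [hiff]
    split_ifs <;> simp
  rw [this, map_smul, Matrix.smul_apply]
  split_ifs
  · rw [one_smul]; rfl
  · rw [zero_smul]

lemma embedObs_comp {f : S → Λ} {g : R → S} (hf : Function.Injective f)
    (B : Matrix (R → Fin q) (R → Fin q) ℂ) :
    embedObs (f ∘ g) B = embedObs f (embedObs g B) := by
  classical
  ext σ τ
  simp only [embedObs_apply]
  have hiff : (∀ x, x ∉ Set.range (f ∘ g) → σ x = τ x) ↔
      (∀ x, x ∉ Set.range f → σ x = τ x) ∧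
        ∀ y, y ∉ Set.range g → (σ ∘ f) y = (τ ∘ f) y := by
    constructor
    · refine fun h => ⟨fun x hx => h x fun ⟨a, ha⟩ => hx ⟨g a, ha⟩, fun y hy => h _ ?_⟩
      rintro ⟨a, ha⟩
      exact hy ⟨a, hf ha⟩
    · rintro ⟨h1, h2⟩ x hx
      by_cases hxf : x ∈ Set.range f
      · obtain ⟨y, rfl⟩ := hxf
        exact h2 y fun ⟨a, ha⟩ => hx ⟨a, congrArg f ha⟩
      · exact h1 x hxf
  simp only [hiff, ite_and]
  rfl

lemma eq_extend_of_eqOn {f : S → Λ} {σ τ : Λ → Fin q} (h : ∀ x, x ∉ Set.range f → σ x = τ x) :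
    Function.extend f (τ ∘ f) σ = τ := by
  conv_rhs => rw [← extend_comp_self f τ]
  classical
  funext x
  by_cases hx : ∃ a, f a = x
  · simp only [Function.extend_def, dif_pos hx]
  · simp only [Function.extend_apply' _ _ _ hx, h x hx]

lemma slice_conjTranspose (f : S → Λ) (σ τ : Λ → Fin q) (A : Matrix (Λ → Fin q) (Λ → Fin q) ℂ) :
    slice f σ τ A.conjTranspose = (slice f τ σ A).conjTranspose := rfl

lemma matrix_ext_slice (f : S → Λ) {A B : Matrix (Λ → Fin q) (Λ → Fin q) ℂ}
    (h : ∀ σ τ, slice f σ τ A = slice f σ τ B) : A = B := by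
  ext σ τ
  rw [← slice_apply_comp f σ τ A, h, slice_apply_comp]

section Star

variable [Fintype S] [Fintype Λ] [DecidableEq Λ] {f : S → Λ}

lemma embedObs_one : embedObs f (1 : Matrix (S → Fin q) (S → Fin q) ℂ) = 1 := by
  classical
  ext σ τ
  rw [embedObs_apply]
  by_cases h1 : ∀ x, x ∉ Set.range f → σ x = τ x
  · rw [if_pos h1]
    by_cases h2 : σ = τ
    · rw [h2, Matrix.one_apply_eq, Matrix.one_apply_eq]
    · rw [Matrix.one_apply_ne h2, Matrix.one_apply_ne fun h3 => h2 ?_]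
      rw [← eq_extend_of_eqOn h1, ← h3, extend_comp_self]
  · rw [if_neg h1, Matrix.one_apply_ne fun h => h1 fun x _ => congrFun h x]

variable [DecidableEq S]

lemma slice_embedObs_mul (hf : Function.Injective f) (σ τ : Λ → Fin q)
    (K : Matrix (S → Fin q) (S → Fin q) ℂ) (A : Matrix (Λ → Fin q) (Λ → Fin q) ℂ) :
    slice f σ τ (embedObs f K * A) = K * slice f σ τ A := by
  classical
  ext s s'
  rw [slice_apply, Matrix.mul_apply, Matrix.mul_apply]
  simp only [embedObs_apply, ite_mul, zero_mul]
  rw [← Finset.sum_filter]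
  refine Finset.sum_nbij' (fun τ' => τ' ∘ f) (fun k => Function.extend f k σ) (by simp)
    (fun k _ => ?_) (fun τ' hτ' => ?_) (fun k _ => Function.extend_comp hf _ _) (fun τ' hτ' => ?_)
  · simp only [Finset.mem_filter, Finset.mem_univ, true_and]
    intro x hx
    rw [Function.extend_apply' _ _ _ hx, Function.extend_apply' _ _ _ hx]
  · refine eq_extend_of_eqOn fun x hx => ?_
    rw [← (Finset.mem_filter.mp hτ').2 x hx, Function.extend_apply' _ _ _ hx]
  · rw [Function.extend_comp hf, slice_apply]
    congr 2
    refine (eq_extend_of_eqOn fun x hx => ?_).symm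
    rw [← (Finset.mem_filter.mp hτ').2 x hx, Function.extend_apply' _ _ _ hx]

lemma slice_mul_embedObs (hf : Function.Injective f) (σ τ : Λ → Fin q)
    (K : Matrix (S → Fin q) (S → Fin q) ℂ) (A : Matrix (Λ → Fin q) (Λ → Fin q) ℂ) :
    slice f σ τ (A * embedObs f K) = slice f σ τ A * K := by
  rw [← Matrix.conjTranspose_conjTranspose (A * embedObs f K), slice_conjTranspose,
    Matrix.conjTranspose_mul, embedObs_conjTranspose, slice_embedObs_mul hf, slice_conjTranspose,
    Matrix.conjTranspose_mul, Matrix.conjTranspose_conjTranspose,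
    Matrix.conjTranspose_conjTranspose]

lemma embedObs_mul (hf : Function.Injective f) (A B : Matrix (S → Fin q) (S → Fin q) ℂ) :
    embedObs f (A * B) = embedObs f A * embedObs f B := by
  classical
  refine matrix_ext_slice f fun σ τ => ?_
  have key : ∀ C : Matrix (S → Fin q) (S → Fin q) ℂ, slice f σ τ (embedObs f C) =
      (if ∀ x, x ∉ Set.range f → σ x = τ x then (1 : ℂ) else 0) • C := by
    intro C
    ext s s'
    rw [slice_apply, embedObs_apply, Function.extend_comp hf, Function.extend_comp hf,
      Matrix.smul_apply]
    have hiff : (∀ x, x ∉ Set.range f → Function.extend f s σ x = Function.extend f s' τ x) ↔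
        ∀ x, x ∉ Set.range f → σ x = τ x := forall₂_congr fun x hx => by
      rw [Function.extend_apply' _ _ _ hx, Function.extend_apply' _ _ _ hx]
    simp only [hiff]
    split_ifs <;> simp
  rw [slice_embedObs_mul hf, key, key, Matrix.mul_smul]

/-- The inclusion of the operators of a subsystem, as a homomorphism of star algebras. -/
noncomputable def embedObsHom (f : S → Λ) (hf : Function.Injective f) :
    Matrix (S → Fin q) (S → Fin q) ℂ →⋆ₐ[ℂ] Matrix (Λ → Fin q) (Λ → Fin q) ℂ where
  toFun := embedObs f
  map_one' := embedObs_one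
  map_mul' := embedObs_mul hf
  map_zero' := by
    ext σ τ
    simp [embedObs_apply]
  map_add' A B := by
    ext σ τ
    rw [Matrix.add_apply, embedObs_apply, embedObs_apply, embedObs_apply]
    split_ifs <;> simp
  commutes' c := by
    rw [Algebra.algebraMap_eq_smul_one, Algebra.algebraMap_eq_smul_one,
      ← embedObs_one (f := f)]
    ext σ τ
    rw [Matrix.smul_apply, embedObs_apply, embedObs_apply]
    split_ifs <;> simp
  map_star' A := (embedObs_conjTranspose f A).symm

lemma norm_embedObs [Nonempty (Λ → Fin q)] (hf : Function.Injective f)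
    (B : Matrix (S → Fin q) (S → Fin q) ℂ) : ‖embedObs f B‖ = ‖B‖ := by
  refine NonUnitalStarAlgHom.norm_map (embedObsHom (q := q) f hf) (fun A B h => ?_) B
  obtain ⟨σ⟩ := ‹Nonempty (Λ → Fin q)›
  rw [← slice_embedObs_self hf σ A, ← slice_embedObs_self hf σ B]
  exact congrArg (slice f σ σ) h

lemma IsLindblad.embedSuper (hf : Function.Injective f) {T : SuperOp (S → Fin q)}
    (hT : IsLindblad T) : IsLindblad (embedSuper f T) := by
  obtain ⟨H, hH, m, K, hK⟩ := hT
  refine ⟨embedObs f H, ?_, m, fun j => embedObs f (K j), fun A => ?_⟩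
  · rw [Matrix.IsHermitian, embedObs_conjTranspose, hH.eq]
  · ext σ τ
    rw [embedSuper_apply, hK]
    refine (congrFun (congrFun ?_ _) _).trans (slice_apply_comp f σ τ _)
    simp only [embedObs_conjTranspose, mul_assoc, map_add, map_sub, map_smul, map_sum,
      slice_embedObs_mul hf, slice_mul_embedObs hf]
    simp only [← mul_assoc, slice_mul_embedObs hf]
    rfl

lemma norm_embedSuper_le (hf : Function.Injective f) {T : SuperOp (S → Fin q)} {κ : ℝ}
    (hκ : 0 ≤ κ) (hT : cbNorm T ≤ ENNReal.ofReal κ) (M : Matrix (Λ → Fin q) (Λ → Fin q) ℂ) :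
    ‖_root_.embedSuper f T M‖ ≤ κ * ‖M‖ := by
  classical
  let O := {x // x ∉ Set.range f} → Fin q
  let e : (Λ → Fin q) ≃ (S → Fin q) × Fin (Fintype.card O) :=
    { toFun := fun σ => (σ ∘ f, Fintype.equivFin O fun x => σ x)
      invFun := fun p => fun x => if hx : x ∈ Set.range f then p.1 hx.choose else
        (Fintype.equivFin O).symm p.2 ⟨x, hx⟩
      left_inv := fun σ => by
        funext x
        by_cases hx : x ∈ Set.range f
        · simp only [dif_pos hx, Function.comp_apply, hx.choose_spec]
        · simp only [dif_neg hx, Equiv.symm_apply_apply]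
      right_inv := fun p => by
        refine Prod.ext ?_ ?_
        · funext a
          have ha : f a ∈ Set.range f := ⟨a, rfl⟩
          simp only [Function.comp_apply, dif_pos ha, hf ha.choose_spec]
        · simp only
          rw [← Equiv.eq_symm_apply]
          funext x
          simp only [dif_neg x.2] }
  have he : ∀ σ s, e.symm (s, (e σ).2) = Function.extend f s σ := by
    intro σ s
    rw [Equiv.symm_apply_eq]
    refine Prod.ext (Function.extend_comp hf _ _).symm ?_
    simp only [e, Equiv.coe_fn_mk, EmbeddingLike.apply_eq_iff_eq]
    funext x
    exact (Function.extend_apply' _ _ _ x.2).symm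
  have h := norm_ampliation_le hκ hT _ (M.submatrix e.symm e.symm)
  rw [Matrix.l2_opNorm_submatrix_equiv, ← Matrix.l2_opNorm_submatrix_equiv e] at h
  refine le_of_eq_of_le ?_ h
  congr 1
  ext σ τ
  rw [embedSuper_apply]
  change _ = T (Matrix.of fun i j => M (e.symm (i, (e σ).2)) (e.symm (j, (e τ).2))) (σ ∘ f) (τ ∘ f)
  refine congrArg (fun N => T N (σ ∘ f) (τ ∘ f)) ?_
  ext s s'
  simp only [slice_apply, Matrix.of_apply, he]

end Star

end Embedding

section Torus

variable {D L : ℕ}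

lemma torusDist_comm (u v : Torus D L) : torusDist u v = torusDist v u :=
  Finset.sum_congr rfl fun i _ => by rw [← ZMod.natAbs_valMinAbs_neg, neg_sub]

lemma torusDist_triangle (u v w : Torus D L) : torusDist u w ≤ torusDist u v + torusDist v w := by
  rw [torusDist, torusDist, torusDist, ← Finset.sum_add_distrib]
  refine Finset.sum_le_sum fun i _ => ?_
  calc (w i - u i).valMinAbs.natAbs = ((v i - u i) + (w i - v i)).valMinAbs.natAbs := by
        rw [sub_add_sub_cancel']
    _ ≤ _ := (ZMod.natAbs_valMinAbs_add_le _ _).trans (Int.natAbs_add_le _ _)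

lemma valMinAbs_intCast_of_lt [NeZero L] {x : ℤ} (h : 2 * x.natAbs < L) :
    ((x : ZMod L)).valMinAbs = x :=
  (ZMod.valMinAbs_spec _ _).mpr ⟨rfl, by constructor <;> omega⟩

lemma natAbs_valMinAbs_intCast_le [NeZero L] (x : ℤ) :
    ((x : ZMod L)).valMinAbs.natAbs ≤ x.natAbs :=
  ZMod.natAbs_min_of_le_div_two L _ _ (by rw [ZMod.coe_valMinAbs]) (ZMod.natAbs_valMinAbs_le _)

lemma torusDist_add_toTorus_le [NeZero L] (u : Torus D L) (x : Fin D → ℤ) :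
    torusDist u (u + toTorus L x) ≤ ∑ i, (x i).natAbs := by
  refine Finset.sum_le_sum fun i _ => ?_
  rw [Pi.add_apply, add_sub_cancel_left]
  exact natAbs_valMinAbs_intCast_le (x i)

lemma torusDist_zero_toTorus_le [NeZero L] (x : Fin D → ℤ) :
    torusDist 0 (toTorus L x) ≤ ∑ i, (x i).natAbs := by
  simpa using torusDist_add_toTorus_le (0 : Torus D L) x

lemma card_torusDist_le [NeZero L] (v : Torus D L) (N : ℕ) :
    (Finset.univ.filter fun u => torusDist v u ≤ N).card ≤ (2 * N + 1) ^ D := by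
  have hcard : (Fintype.piFinset fun _ : Fin D => Finset.Icc (-(N : ℤ)) N).card =
      (2 * N + 1) ^ D := by
    rw [Fintype.card_piFinset]
    simp only [Int.card_Icc, Finset.prod_const, Finset.card_univ, Fintype.card_fin]
    congr 1
    omega
  rw [← hcard]
  refine Finset.card_le_card_of_injOn (fun u i => (u i - v i).valMinAbs) (fun u hu => ?_)
    fun u _ u' _ h => ?_
  · have hu : torusDist v u ≤ N := by simpa using hu
    simp only [Finset.mem_coe, Fintype.mem_piFinset, Finset.mem_Icc]
    intro i
    have : (u i - v i).valMinAbs.natAbs ≤ N :=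
      (Finset.single_le_sum (f := fun i => (u i - v i).valMinAbs.natAbs)
        (fun _ _ => Nat.zero_le _) (Finset.mem_univ i)).trans hu
    omega
  · funext i
    have := congrFun h i
    simpa using this

/-- Reduction modulo `L'` followed by lifting to the coordinates of smallest absolute value. -/
def torusLift {D : ℕ} (L' L : ℕ) (u : Torus D L') : Torus D L := toTorus L fun i => (u i).valMinAbs

lemma torusLift_injective {L' : ℕ} [NeZero L'] [NeZero L] (h : L' < L) :
    Function.Injective (torusLift L' L : Torus D L' → Torus D L) := by
  intro u v huv
  funext i
  have h1 := congrArg ZMod.valMinAbs (congrFun huv i)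
  have hu := ZMod.natAbs_valMinAbs_le (u i)
  have hv := ZMod.natAbs_valMinAbs_le (v i)
  simp only [torusLift, toTorus] at h1
  rw [valMinAbs_intCast_of_lt (by omega), valMinAbs_intCast_of_lt (by omega)] at h1
  exact ZMod.injective_valMinAbs h1

lemma torusLift_toTorus {L' : ℕ} [NeZero L'] {x : Fin D → ℤ} (hx : ∀ i, 2 * (x i).natAbs < L') :
    torusLift L' L (toTorus L' x) = toTorus L x := by
  funext i
  simp only [torusLift, toTorus]
  rw [valMinAbs_intCast_of_lt (hx i)]

lemma toTorus_add (x y : Fin D → ℤ) : toTorus L (x + y) = toTorus L x + toTorus L y := by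
  funext i
  simp [toTorus]

/-- The cube of side `2 R + 1` around the origin. -/
noncomputable def latticeCube (D R : ℕ) : Finset (Fin D → ℤ) := Fintype.piFinset fun _ => Finset.Icc (-(R : ℤ)) R

lemma mem_latticeCube {R : ℕ} {x : Fin D → ℤ} : x ∈ latticeCube D R ↔ ∀ i, (x i).natAbs ≤ R := by
  simp only [latticeCube, Fintype.mem_piFinset, Finset.mem_Icc]
  exact forall_congr' fun i => by omega

lemma toTorus_injOn_latticeCube [NeZero L] {R : ℕ} (h : 2 * R < L) :
    Set.InjOn (toTorus L) (latticeCube D R : Set (Fin D → ℤ)) := by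
  intro x hx y hy hxy
  have hx := mem_latticeCube.mp hx
  have hy := mem_latticeCube.mp hy
  funext i
  have h1 := congrArg ZMod.valMinAbs (congrFun hxy i)
  simp only [toTorus] at h1
  have := hx i
  have := hy i
  rwa [valMinAbs_intCast_of_lt (by omega), valMinAbs_intCast_of_lt (by omega)] at h1

lemma mem_image_latticeCube [NeZero L] {R : ℕ} {u : Torus D L} (hu : torusDist 0 u ≤ R) :
    u ∈ (latticeCube D R).image (toTorus L) := by
  refine Finset.mem_image.mpr ⟨fun i => (u i).valMinAbs, mem_latticeCube.mpr fun i => ?_, ?_⟩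
  · refine le_trans ?_ hu
    have := Finset.single_le_sum (f := fun i => (u i - (0 : Torus D L) i).valMinAbs.natAbs)
        (fun _ _ => Nat.zero_le _) (Finset.mem_univ i)
    simpa [torusDist] using this
  · funext i
    simp [toTorus]

lemma natAbs_nbhdVec_le (a : NbhdSite D) (i : Fin D) : (nbhdVec a i).natAbs ≤ 1 := by
  match a with
  | none => simp [nbhdVec]
  | some (j, true) => by_cases h : i = j <;> simp [nbhdVec, h]
  | some (j, false) => by_cases h : i = j <;> simp [nbhdVec, h]

lemma sum_natAbs_nbhdVec_le (a : NbhdSite D) : ∑ i, (nbhdVec a i).natAbs ≤ 1 := by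
  match a with
  | none => simp [nbhdVec]
  | some (j, true) => simp [nbhdVec, Pi.single_apply, apply_ite Int.natAbs]
  | some (j, false) => simp [nbhdVec, Pi.single_apply, apply_ite Int.natAbs]

lemma nbhdVec_injective : Function.Injective (nbhdVec : NbhdSite D → Fin D → ℤ) := by
  intro a b h
  match a, b with
  | none, none => rfl
  | none, some (j, true) => simpa [nbhdVec] using congrFun h j
  | none, some (j, false) => simpa [nbhdVec] using congrFun h j
  | some (j, true), none => simpa [nbhdVec] using congrFun h j
  | some (j, false), none => simpa [nbhdVec] using congrFun h j
  | some (j, true), some (k, true) =>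
    by_cases hjk : j = k
    · rw [hjk]
    · simpa [nbhdVec, Pi.single_apply, hjk] using congrFun h j
  | some (j, false), some (k, false) =>
    by_cases hjk : j = k
    · rw [hjk]
    · simpa [nbhdVec, Pi.single_apply, hjk] using congrFun h j
  | some (j, true), some (k, false) =>
    by_cases hjk : j = k
    · simpa [nbhdVec, Pi.single_apply, hjk] using congrFun h j
    · simpa [nbhdVec, Pi.single_apply, hjk] using congrFun h j
  | some (j, false), some (k, true) =>
    by_cases hjk : j = k
    · simpa [nbhdVec, Pi.single_apply, hjk] using congrFun h j
    · simpa [nbhdVec, Pi.single_apply, hjk] using congrFun h j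

lemma nbhd_injective [NeZero L] (hL : 3 ≤ L) (u : Torus D L) :
    Function.Injective fun a : NbhdSite D => u + toTorus L (nbhdVec a) := by
  intro a b h
  refine nbhdVec_injective (toTorus_injOn_latticeCube (L := L) (R := 1) (by omega)
    (mem_latticeCube.mpr (natAbs_nbhdVec_le a)) (mem_latticeCube.mpr (natAbs_nbhdVec_le b)) ?_)
  exact add_left_cancel h

/-- The exponential weights of the sites are compatible with balls of radius `a`. -/
lemma sum_exp_torusDist_le [NeZero L] (a : ℕ) (v : Torus D L) :
    ∑ u with v ∈ Finset.univ.filter (fun v => torusDist u v ≤ a), Real.exp (torusDist 0 u) ≤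
      ((2 * a + 1) ^ D * Real.exp a) * Real.exp (torusDist 0 v) := by
  calc _ ≤ ∑ u with v ∈ Finset.univ.filter (fun v => torusDist u v ≤ a),
        Real.exp a * Real.exp (torusDist 0 v) := by
        refine Finset.sum_le_sum fun u hu => ?_
        have hu : torusDist u v ≤ a := by simpa using hu
        rw [← Real.exp_add]
        refine Real.exp_le_exp.mpr ?_
        have h1 := torusDist_triangle 0 v u
        rw [torusDist_comm v u] at h1
        have : torusDist 0 u ≤ a + torusDist 0 v := by omega
        exact_mod_cast this
    _ = ((Finset.univ.filter fun u => torusDist v u ≤ a).card : ℝ) *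
          (Real.exp a * Real.exp (torusDist 0 v)) := by
        rw [Finset.sum_const, nsmul_eq_mul]
        simp only [Finset.mem_filter, Finset.mem_univ, true_and, torusDist_comm v]
    _ ≤ ((2 * a + 1) ^ D : ℝ) * (Real.exp a * Real.exp (torusDist 0 v)) := by
        gcongr
        exact_mod_cast card_torusDist_le v a
    _ = _ := by ring

end Torus

section LocalDynamics

variable {D q L : ℕ} [NeZero L] {ℓ : SuperOp (NbhdSite D → Fin q)}

lemma torusDist_nbhd_le (u : Torus D L) {x : Torus D L}
    (hx : x ∈ Set.range fun a : NbhdSite D => u + toTorus L (nbhdVec a)) : torusDist u x ≤ 1 := by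
  obtain ⟨a, rfl⟩ := hx
  exact (torusDist_add_toTorus_le u _).trans (sum_natAbs_nbhdVec_le a)

lemma IsLindblad.localTerm (hℓ : IsLindblad ℓ) (hL : 3 ≤ L) (u : Torus D L) :
    IsLindblad (localTerm ℓ L u) :=
  hℓ.embedSuper (nbhd_injective hL u)

lemma norm_localTerm_le (hℓ1 : cbNorm ℓ ≤ 1) (hL : 3 ≤ L) (u : Torus D L) (A : Obs D L q) :
    ‖localTerm ℓ L u A‖ ≤ ‖A‖ := by
  have h := norm_embedSuper_le (nbhd_injective hL u) zero_le_one (by simpa using hℓ1) A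
  rwa [one_mul] at h

/-- A superoperator acting on the ball of radius `m` around `u` annihilates the operators which
live far from `u`. -/
lemma embedSuper_embedObs_eq_zero {R S : Type} [Fintype S] [DecidableEq S] {f : S → Torus D L}
    (hf : Function.Injective f) {u : Torus D L} {m : ℕ} (hfu : ∀ x ∈ Set.range f, torusDist u x ≤ m)
    {T : SuperOp (S → Fin q)} (hT : embedSuper f T 1 = 0) {g : R → Torus D L} {b : ℕ}
    (hg : ∀ s, torusDist 0 (g s) ≤ b) (hu : ¬ torusDist 0 u ≤ b + m)
    (B : Matrix (R → Fin q) (R → Fin q) ℂ) : embedSuper f T (embedObs g B) = 0 := by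
  refine embedSuper_embedObs_of_disjoint hf (Set.disjoint_left.mpr ?_) hT B
  rintro _ hx ⟨s, rfl⟩
  have h1 := torusDist_triangle 0 (g s) u
  rw [torusDist_comm (g s)] at h1
  have := hfu _ hx
  have := hg s
  omega

lemma localTerm_embedObs_eq_zero {R : Type} (hℓ : IsLindblad ℓ) (hL : 3 ≤ L)
    {g : R → Torus D L} {b : ℕ}
    (hg : ∀ s, torusDist 0 (g s) ≤ b) {u : Torus D L} (hu : ¬ torusDist 0 u ≤ b + 1)
    (B : Matrix (R → Fin q) (R → Fin q) ℂ) : localTerm ℓ L u (embedObs g B) = 0 :=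
  embedSuper_embedObs_eq_zero (nbhd_injective hL u) (fun _ => torusDist_nbhd_le u)
    (hℓ.localTerm hL u).map_one hg hu B

lemma embedSuper_localTerm_comm {S : Type} [Fintype S] [DecidableEq S] {f : S → Torus D L}
    {u v : Torus D L} {m : ℕ} (hfu : ∀ x ∈ Set.range f, torusDist u x ≤ m)
    (huv : ¬ torusDist u v ≤ m + 1) (T : SuperOp (S → Fin q)) (A : Obs D L q) :
    embedSuper f T (localTerm ℓ L v A) = localTerm ℓ L v (embedSuper f T A) := by
  refine embedSuper_comm (Set.disjoint_left.mpr ?_) T ℓ A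
  intro x hx hx'
  have h1 := torusDist_triangle u x v
  rw [torusDist_comm x] at h1
  have := hfu _ hx
  have := torusDist_nbhd_le v hx'
  omega

lemma sum_exp_mul_norm_le {K : Torus D L → SuperOp (Config D L q)} {κ : ℝ} (hκ : 0 ≤ κ)
    (hK : ∀ u A, ‖K u A‖ ≤ κ * ‖A‖) {A : Obs D L q} {b : ℕ}
    (hKA : ∀ u, ¬ torusDist 0 u ≤ b → K u A = 0) :
    ∑ u, Real.exp (torusDist 0 u) * ‖K u A‖ ≤ κ * ((2 * b + 1) ^ D * Real.exp b * ‖A‖) := by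
  calc _ = ∑ u with torusDist 0 u ≤ b, Real.exp (torusDist 0 u) * ‖K u A‖ := by
        rw [Finset.sum_filter]
        refine Finset.sum_congr rfl fun u _ => ?_
        split_ifs with h
        · rfl
        · rw [hKA u h, norm_zero, mul_zero]
    _ ≤ ∑ u : Torus D L with torusDist 0 u ≤ b, Real.exp b * (κ * ‖A‖) := by
        refine Finset.sum_le_sum fun u hu => ?_
        have hu : torusDist 0 u ≤ b := by simpa using hu
        gcongr
        exact hK u A
    _ = ((Finset.univ.filter fun u : Torus D L => torusDist 0 u ≤ b).card : ℝ) *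
          (Real.exp b * (κ * ‖A‖)) := by
        rw [Finset.sum_const, nsmul_eq_mul]
    _ ≤ ((2 * b + 1) ^ D : ℝ) * (Real.exp b * (κ * ‖A‖)) := by
        gcongr
        exact_mod_cast card_torusDist_le (0 : Torus D L) b
    _ = _ := by ring

/-- The prefactor in the Lieb–Robinson bound. -/
noncomputable def lrConst (D b : ℕ) : ℝ := (2 * b + 1) ^ D * Real.exp b

/-- The velocity in the Lieb–Robinson bound, for superoperators with ranges adding up to `a`. -/
noncomputable def lrVelocity (D a : ℕ) : ℝ := (2 * a + 1) ^ D * Real.exp a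

lemma lrConst_nonneg (D b : ℕ) : 0 ≤ lrConst D b := by unfold lrConst; positivity

lemma one_le_lrVelocity (D a : ℕ) : 1 ≤ lrVelocity D a :=
  one_le_mul_of_one_le_of_one_le (one_le_pow₀ (by linarith [(Nat.cast_nonneg a : (0 : ℝ) ≤ a)]))
    (Real.one_le_exp (Nat.cast_nonneg a))

lemma dissipative_sum_localTerm (hℓ : IsLindblad ℓ) (hL : 3 ≤ L) (s : Finset (Torus D L)) :
    Dissipative (∑ v ∈ s, localTerm ℓ L v) :=
  (IsLindblad.sum s _ fun v _ => hℓ.localTerm hL v).dissipative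

/-- Lieb–Robinson bound for the translation-invariant dynamics. -/
lemma evolve_lieb_robinson (hℓ : IsLindblad ℓ) (hℓ1 : cbNorm ℓ ≤ 1) (hL : 3 ≤ L)
    {A : Obs D L q} {r b : ℕ} (hA : ∀ u, ¬ torusDist 0 u ≤ b → localTerm ℓ L u A = 0)
    {K : Torus D L → SuperOp (Config D L q)} {κ : ℝ} (hκ : 0 ≤ κ)
    (hK : ∀ u A, ‖K u A‖ ≤ κ * ‖A‖) (hKA : ∀ u, ¬ torusDist 0 u ≤ b → K u A = 0)
    (hKL : ∀ u v, ¬ torusDist u v ≤ r + 2 → ∀ A, K u (localTerm ℓ L v A) = localTerm ℓ L v (K u A))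
    {t : ℝ} (ht : 0 ≤ t) :
    ∑ u, Real.exp (torusDist 0 u) * ‖localTerm ℓ L u (evolve (liouvillian ℓ L) t A)‖ ≤
        lrConst D b * ‖A‖ * Real.exp (lrVelocity D (r + 2) * t) ∧
      ∑ u, Real.exp (torusDist 0 u) * ‖K u (evolve (liouvillian ℓ L) t A)‖ ≤
        κ * (lrConst D b * ‖A‖ * Real.exp (lrVelocity D (r + 2) * t)) := by
  have h1 := sum_exp_mul_norm_le zero_le_one
    (fun u A => by simpa using norm_localTerm_le hℓ1 hL u A) hA
  have h2 := sum_exp_mul_norm_le hκ hK hKA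
  refine lieb_robinson (L := localTerm ℓ L) (y := fun t => evolve (liouvillian ℓ L) t A)
    (S := fun u => Finset.univ.filter fun v => torusDist u v ≤ r + 2)
    (dissipative_sum_localTerm hℓ hL)
    (fun t => hasDerivAt_evolve _ A t) (norm_localTerm_le hℓ1 hL) hκ hK (fun u v huv => ?_)
    (fun u v huv A => ?_) (fun u => (Real.exp_pos _).le)
    (zero_le_one.trans (one_le_lrVelocity D (r + 2))) (fun v => ?_) ?_ ?_ ht
  · exact hKL u v (by simpa using huv)
  · have huv : ¬ torusDist u v ≤ r + 2 := by simpa using huv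
    exact embedSuper_localTerm_comm (m := 1) (fun _ => torusDist_nbhd_le u) (by omega) ℓ A
  · exact sum_exp_torusDist_le (r + 2) v
  · simp only [evolve_zero]
    simpa [lrConst] using h1
  · simp only [evolve_zero]
    exact h2

/-- The sum of the local terms centred in a cube. -/
noncomputable def cubeLiouvillian (ℓ : SuperOp (NbhdSite D → Fin q)) (L R : ℕ) :
    SuperOp (Config D L q) :=
  ∑ x ∈ latticeCube D R, localTerm ℓ L (toTorus L x)

lemma cubeLiouvillian_isLindblad (hℓ : IsLindblad ℓ) (hL : 3 ≤ L) (R : ℕ) :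
    IsLindblad (cubeLiouvillian ℓ L R) :=
  IsLindblad.sum _ _ fun _ _ => hℓ.localTerm hL _

lemma norm_evolve_sub_evolve_cube_le (hℓ : IsLindblad ℓ) (hℓ1 : cbNorm ℓ ≤ 1) (hL : 3 ≤ L)
    {A : Obs D L q} (r : ℕ) {b : ℕ} (hA : ∀ u, ¬ torusDist 0 u ≤ b → localTerm ℓ L u A = 0) {R : ℕ}
    (hR : 2 * R < L) {t : ℝ} (ht : 0 ≤ t) :
    ‖evolve (liouvillian ℓ L) t A - evolve (cubeLiouvillian ℓ L R) t A‖ ≤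
      Real.exp (-R) * (lrConst D b * ‖A‖) * Real.exp (lrVelocity D (r + 2) * t) := by
  have hsum : cubeLiouvillian ℓ L R =
      ∑ v ∈ (latticeCube D R).image (toTorus L), localTerm ℓ L v :=
    (Finset.sum_image (toTorus_injOn_latticeCube hR)).symm
  have hLR := fun t ht => (evolve_lieb_robinson hℓ hℓ1 hL (r := r) hA (K := fun _ => 0) le_rfl
    (fun u A => by simp) (fun u _ => rfl) (fun u v _ A => by simp) (t := t) ht).1
  rw [hsum, Real.exp_neg]
  refine norm_flow_sub_truncated_le (L := localTerm ℓ L)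
    (y := fun t => evolve (liouvillian ℓ L) t A) (w := fun u => Real.exp (torusDist 0 u))
    (fun t => hasDerivAt_evolve _ A t) (dissipative_sum_localTerm hℓ hL _)
    (fun t => hasDerivAt_evolve _ A t) (by simp only [evolve_zero])
    (fun u => (Real.exp_pos _).le) (one_le_lrVelocity D (r + 2))
    (mul_nonneg (lrConst_nonneg D b) (norm_nonneg A)) (Real.exp_pos _) (fun u hu => ?_)
    hLR ht
  refine Real.exp_le_exp.mpr ?_
  have : R ≤ torusDist 0 u := by
    by_contra h
    exact hu (mem_image_latticeCube (by omega))
  exact_mod_cast this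

/-- The dynamics generated in a cube does not depend on the size of the torus. -/
lemma evolve_cube_torusLift (hℓ : IsLindblad ℓ) (hL : 3 ≤ L) {L' : ℕ} [NeZero L'] (hLL : L' < L)
    {R : ℕ} (hR : 2 * (R + 1) < L') (A : Obs D L' q) {t : ℝ} (ht : 0 ≤ t) :
    evolve (cubeLiouvillian ℓ L R) t (embedObs (torusLift L' L) A) =
      embedObs (torusLift L' L) (evolve (cubeLiouvillian ℓ L' R) t A) := by
  have hinj := torusLift_injective (D := D) hLL
  let φ := (embedObsHom (q := q) (torusLift L' L : Torus D L' → Torus D L) hinj).toAlgHom.toLinearMap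
  have hφ : ∀ A, φ A = embedObs (torusLift L' L) A := fun _ => rfl
  have hloc : ∀ B : Obs D L' q, cubeLiouvillian ℓ L R (φ B) = φ (cubeLiouvillian ℓ L' R B) := by
    intro B
    rw [cubeLiouvillian, cubeLiouvillian, LinearMap.sum_apply, LinearMap.sum_apply, map_sum]
    refine Finset.sum_congr rfl fun x hx => ?_
    have hx := mem_latticeCube.mp hx
    rw [hφ, hφ, localTerm, localTerm, ← embedSuper_comp_embedObs hinj]
    congr 2
    funext a
    rw [Function.comp_apply, ← toTorus_add, ← toTorus_add, torusLift_toTorus]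
    intro i
    have h1 := hx i
    have h2 := natAbs_nbhdVec_le a i
    have h3 := Int.natAbs_add_le (x i) (nbhdVec a i)
    rw [Pi.add_apply]
    omega
  have hder : ∀ t, HasDerivAt (fun t => evolve (cubeLiouvillian ℓ L R) t (φ A) -
      φ (evolve (cubeLiouvillian ℓ L' R) t A))
      (cubeLiouvillian ℓ L R (evolve (cubeLiouvillian ℓ L R) t (φ A) -
        φ (evolve (cubeLiouvillian ℓ L' R) t A)) + 0) t := by
    intro t
    have h2 := ((LinearMap.toContinuousLinearMap φ).restrictScalars
      ℝ).hasFDerivAt.comp_hasDerivAt t (hasDerivAt_evolve (cubeLiouvillian ℓ L' R) A t)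
    refine ((hasDerivAt_evolve (cubeLiouvillian ℓ L R) (φ A) t).sub h2).congr_deriv ?_
    rw [map_sub, hloc, add_zero]
    rfl
  have := (cubeLiouvillian_isLindblad hℓ hL R).dissipative.norm_le hder (B := fun _ => 0)
    (β := fun _ => 0) (fun t => hasDerivAt_const _ _) (fun _ _ => by simp)
    (by simp [evolve_zero]) ht
  exact sub_eq_zero.mp (norm_le_zero_iff.mp this)

end LocalDynamics

section States

open scoped MatrixOrder in
lemma IsDensity.norm_trace_mul_le {ι : Type} [Fintype ι] [DecidableEq ι] {σ : Matrix ι ι ℂ}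
    (hσ : IsDensity σ) (M : Matrix ι ι ℂ) : ‖(σ * M).trace‖ ≤ ‖M‖ := by
  obtain ⟨hpos, htr⟩ := hσ
  obtain ⟨R, rfl⟩ := CStarAlgebra.nonneg_iff_eq_star_mul_self.mp
    (Matrix.nonneg_iff_posSemidef.mpr hpos)
  rw [Matrix.star_eq_conjTranspose] at htr ⊢
  let x : ι → EuclideanSpace ℂ ι := fun i => WithLp.toLp 2 (star (R i))
  have h1 : (R.conjTranspose * R * M).trace =
      ∑ i, inner ℂ (x i) (Matrix.toEuclideanCLM (n := ι) (𝕜 := ℂ) M (x i)) := by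
    rw [mul_assoc, Matrix.trace_mul_comm, Matrix.trace]
    refine Finset.sum_congr rfl fun i _ => ?_
    rw [EuclideanSpace.inner_eq_star_dotProduct, Matrix.ofLp_toEuclideanCLM, Matrix.diag_apply,
      mul_assoc, Matrix.mul_apply, dotProduct]
    refine Finset.sum_congr rfl fun j _ => ?_
    simp [x, Matrix.mulVec, dotProduct, Matrix.mul_apply, mul_comm]
  have h2 : (∑ i, ‖x i‖ ^ 2 : ℝ) = 1 := by
    have : ((∑ i, ‖x i‖ ^ 2 : ℝ) : ℂ) = 1 := by
      rw [← htr, Matrix.trace_mul_comm, Matrix.trace, Complex.ofReal_sum]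
      refine Finset.sum_congr rfl fun i _ => ?_
      rw [EuclideanSpace.norm_sq_eq, Matrix.diag_apply, Matrix.mul_apply, Complex.ofReal_sum]
      refine Finset.sum_congr rfl fun j _ => ?_
      simp [x, Complex.mul_conj, Complex.normSq_eq_norm_sq]
    exact_mod_cast this
  rw [h1]
  calc _ ≤ ∑ i, ‖x i‖ * (‖M‖ * ‖x i‖) := by
        refine (norm_sum_le _ _).trans (Finset.sum_le_sum fun i _ => ?_)
        refine (norm_inner_le_norm _ _).trans ?_
        gcongr
        exact (Matrix.toEuclideanCLM (n := ι) (𝕜 := ℂ) M).le_opNorm (x i)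
    _ = ‖M‖ * ∑ i, ‖x i‖ ^ 2 := by
        rw [Finset.mul_sum]
        exact Finset.sum_congr rfl fun i _ => by ring
    _ = ‖M‖ := by rw [h2, mul_one]

end States

section Support

variable {Λ : Type} {q : ℕ}

lemma ObsSupportedOn.mono {X Y : Set Λ} (h : X ⊆ Y) {A : Matrix (Λ → Fin q) (Λ → Fin q) ℂ}
    (hA : ObsSupportedOn X A) : ObsSupportedOn Y A := by
  obtain ⟨B, rfl⟩ := hA
  exact ⟨embedObs (Set.inclusion h) B, embedObs_comp (f := (Subtype.val : Y → Λ))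
    (g := Set.inclusion h) Subtype.val_injective B⟩

variable [Fintype Λ] [DecidableEq Λ]

lemma ObsSupportedOn.one (X : Set Λ) :
    ObsSupportedOn X (1 : Matrix (Λ → Fin q) (Λ → Fin q) ℂ) := by
  classical
  exact ⟨1, embedObs_one.symm⟩

lemma ObsSupportedOn.mul {X : Set Λ} {A B : Matrix (Λ → Fin q) (Λ → Fin q) ℂ}
    (hA : ObsSupportedOn X A) (hB : ObsSupportedOn X B) : ObsSupportedOn X (A * B) := by
  classical
  obtain ⟨A', rfl⟩ := hA
  obtain ⟨B', rfl⟩ := hB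
  exact ⟨A' * B', (embedObs_mul Subtype.val_injective A' B').symm⟩

lemma ObsSupportedOn.list_prod {X : Set Λ} :
    ∀ l : List (Matrix (Λ → Fin q) (Λ → Fin q) ℂ), (∀ A ∈ l, ObsSupportedOn X A) →
      ObsSupportedOn X l.prod
  | [], _ => by simpa using ObsSupportedOn.one X
  | A :: l, h => by
    rw [List.prod_cons]
    exact (h A (by simp)).mul (list_prod l fun B hB => h B (by simp [hB]))

lemma norm_list_prod_le {ι : Type} [Fintype ι] [DecidableEq ι] :
    ∀ l : List (Matrix ι ι ℂ), ‖l.prod‖ ≤ (l.map fun A => ‖A‖).prod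
  | [] => by
    rcases isEmpty_or_nonempty ι with h | h
    · rw [Subsingleton.elim (List.prod []) (0 : Matrix ι ι ℂ)]
      simp
    · simp
  | A :: l => by
    rw [List.prod_cons, List.map_cons, List.prod_cons]
    exact (norm_mul_le _ _).trans (mul_le_mul_of_nonneg_left (norm_list_prod_le l) (norm_nonneg _))

end Support

section Rates

lemma exists_pow_le_mul_exp {α β κ : ℝ} (hα : 0 ≤ α) (hβ : 0 < β) (hκ : 0 < κ) (m : ℕ) :
    ∃ K : ℝ, 0 < K ∧ ∀ t : ℝ, 0 ≤ t → (α + β * t) ^ m ≤ K * Real.exp (κ * t) := by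
  have hl : 0 < κ / β := div_pos hκ hβ
  refine ⟨m.factorial * Real.exp (κ / β * α) / (κ / β) ^ m, by positivity, fun t ht => ?_⟩
  have h := Real.pow_div_factorial_le_exp (x := κ / β * (α + β * t)) (by positivity) m
  have he : κ / β * (α + β * t) = κ / β * α + κ * t := by field_simp
  rw [div_le_iff₀ (by positivity), mul_pow, he, Real.exp_add] at h
  rw [div_mul_eq_mul_div, le_div_iff₀ (by positivity)]
  linarith

/-- The radius of the region reached at time `t`, for observables of size `b` and velocity `M`. -/
noncomputable def coneRadius (M : ℝ) (b : ℕ) (t : ℝ) : ℕ := ⌈(M + 1) * t⌉₊ + b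

lemma exp_neg_coneRadius_le (M : ℝ) (b : ℕ) (t : ℝ) :
    Real.exp (-(coneRadius M b t : ℝ)) * Real.exp (M * t) ≤ Real.exp (-t) := by
  rw [← Real.exp_add]
  refine Real.exp_le_exp.mpr ?_
  have := Nat.le_ceil ((M + 1) * t)
  have hb : (0 : ℝ) ≤ b := Nat.cast_nonneg b
  rw [coneRadius]
  push_cast
  linarith

lemma exists_rate_bound (D b : ℕ) {G M c γ : ℝ} (δ : ℝ) (hG : 0 ≤ G) (hM : 0 ≤ M) (hc : 0 ≤ c)
    (hγ : 0 < γ) : ∃ C κ : ℝ, 0 < C ∧ 0 < κ ∧ ∀ t : ℝ, 0 ≤ t →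
      (2 * (coneRadius M b t : ℝ) + 1) ^ D * (2 * (G * Real.exp (-t)) +
        c * (2 * (coneRadius M b t : ℝ) + 3) ^ δ * Real.exp (-γ * t)) + G * Real.exp (-t) ≤
      C * Real.exp (-κ * t) := by
  set κ₀ := min 1 γ with hκ₀
  have hκ₀pos : 0 < κ₀ := lt_min one_pos hγ
  obtain ⟨K, hK, hpow⟩ := exists_pow_le_mul_exp (α := 2 * b + 5) (β := 2 * (M + 1)) (κ := κ₀ / 2)
    (by positivity) (by positivity) (by positivity) (D + ⌈δ⌉₊)
  refine ⟨K * (3 * G + c) + 1, κ₀ / 2, by positivity, by positivity, fun t ht => ?_⟩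
  set p : ℝ := 2 * (coneRadius M b t : ℝ) + 3 with hp
  have hR : (0 : ℝ) ≤ coneRadius M b t := Nat.cast_nonneg _
  have hp1 : 1 ≤ p := by linarith
  have hple : p ≤ 2 * b + 5 + 2 * (M + 1) * t := by
    have := (Nat.ceil_lt_add_one (a := (M + 1) * t) (by positivity)).le
    rw [hp, coneRadius]
    push_cast
    linarith
  have e1 : Real.exp (-t) ≤ Real.exp (-κ₀ * t) := Real.exp_le_exp.mpr (by
    nlinarith [min_le_left 1 γ])
  have e2 : Real.exp (-γ * t) ≤ Real.exp (-κ₀ * t) := Real.exp_le_exp.mpr (by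
    nlinarith [min_le_right 1 γ])
  have hrpow : p ^ δ ≤ p ^ ⌈δ⌉₊ := by
    rw [← Real.rpow_natCast]
    exact Real.rpow_le_rpow_of_exponent_le hp1 (Nat.le_ceil δ)
  have hpD : (1 : ℝ) ≤ p ^ D := one_le_pow₀ hp1
  have hpn : (1 : ℝ) ≤ p ^ ⌈δ⌉₊ := one_le_pow₀ hp1
  have hexp := Real.exp_pos (-κ₀ * t)
  calc _ ≤ p ^ D * (2 * (G * Real.exp (-κ₀ * t)) + c * p ^ ⌈δ⌉₊ * Real.exp (-κ₀ * t)) +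
        G * Real.exp (-κ₀ * t) := by
        gcongr
        linarith
    _ ≤ p ^ D * (2 * (p ^ ⌈δ⌉₊ * (G * Real.exp (-κ₀ * t))) +
          c * p ^ ⌈δ⌉₊ * Real.exp (-κ₀ * t)) +
          p ^ D * (p ^ ⌈δ⌉₊ * (G * Real.exp (-κ₀ * t))) := by
        have h0 : 0 ≤ G * Real.exp (-κ₀ * t) := by positivity
        have h1 : G * Real.exp (-κ₀ * t) ≤ p ^ ⌈δ⌉₊ * (G * Real.exp (-κ₀ * t)) :=
          le_mul_of_one_le_left h0 hpn
        have h2 : p ^ ⌈δ⌉₊ * (G * Real.exp (-κ₀ * t)) ≤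
            p ^ D * (p ^ ⌈δ⌉₊ * (G * Real.exp (-κ₀ * t))) :=
          le_mul_of_one_le_left (h0.trans h1) hpD
        exact add_le_add (mul_le_mul_of_nonneg_left (by linarith) (by positivity)) (h1.trans h2)
    _ = p ^ (D + ⌈δ⌉₊) * (3 * G + c) * Real.exp (-κ₀ * t) := by rw [pow_add]; ring
    _ ≤ (K * Real.exp (κ₀ / 2 * t)) * (3 * G + c) * Real.exp (-κ₀ * t) := by
        gcongr
        exact (pow_le_pow_left₀ (by linarith) hple _).trans (hpow t ht)
    _ = K * (3 * G + c) * Real.exp (-(κ₀ / 2) * t) := by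
        rw [show -(κ₀ / 2) * t = κ₀ / 2 * t + -κ₀ * t by ring, Real.exp_add]
        ring
    _ ≤ _ := by
        gcongr
        linarith

end Rates

section Stability

variable {D q : ℕ} {ℓ : SuperOp (NbhdSite D → Fin q)}

lemma torusDist_zero_le_of_mem_image {L b : ℕ} [NeZero L] {X : Finset (Fin D → ℤ)}
    (hX : ∀ x ∈ X, ∑ i, (x i).natAbs ≤ b) (s : toTorus L '' (X : Set (Fin D → ℤ))) :
    torusDist 0 (s : Torus D L) ≤ b := by
  obtain ⟨_, x, hx, rfl⟩ := s
  exact (torusDist_zero_toTorus_le x).trans (hX x hx)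

/-- Mixing of local observables, uniformly in the system size: up to the propagation error, the
observable sees only a torus of side `2 R + 3`. -/
lemma exists_norm_evolve_sub_smul_one_le (hℓ : IsLindblad ℓ) (hℓ1 : cbNorm ℓ ≤ 1)
    {ρ : ∀ (L : ℕ) [NeZero L], Obs D L q} {c δ γ : ℝ} (hc : 0 < c) (hδ : 0 < δ)
    (hmix : ∀ (L : ℕ) [NeZero L], 3 ≤ L → ∀ (A : Obs D L q) (t : ℝ), 0 ≤ t →
      ‖evolve (liouvillian ℓ L) t A - (A * ρ L).trace • (1 : Obs D L q)‖ ≤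
        c * (L : ℝ) ^ δ * Real.exp (-γ * t) * ‖A‖)
    {X : Finset (Fin D → ℤ)} {b : ℕ} (hX : ∀ x ∈ X, ∑ i, (x i).natAbs ≤ b) (r : ℕ)
    {L : ℕ} [NeZero L] (hL : 3 ≤ L) {A : Obs D L q}
    (hA : ObsSupportedOn (toTorus L '' (X : Set (Fin D → ℤ))) A) {R : ℕ} (hR : b ≤ R)
    {t : ℝ} (ht : 0 ≤ t) :
    ∃ a : ℂ, ‖evolve (liouvillian ℓ L) t A - a • (1 : Obs D L q)‖ ≤
      (2 * (Real.exp (-R) * lrConst D (b + r + 1) * Real.exp (lrVelocity D (r + 2) * t)) +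
        c * (2 * R + 3) ^ δ * Real.exp (-γ * t)) * ‖A‖ := by
  have hG := lrConst_nonneg D (b + r + 1)
  rcases isEmpty_or_nonempty (Config D L q) with hemp | hne
  · refine ⟨0, ?_⟩
    rw [Subsingleton.elim (evolve (liouvillian ℓ L) t A - (0 : ℂ) • (1 : Obs D L q)) 0, norm_zero]
    positivity
  by_cases hLR : L ≤ 2 * R + 3
  · refine ⟨_, (hmix L hL A t ht).trans ?_⟩
    gcongr
    have h1 : (L : ℝ) ^ δ ≤ (2 * R + 3 : ℝ) ^ δ :=
      Real.rpow_le_rpow (Nat.cast_nonneg L) (by exact_mod_cast hLR) hδ.le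
    have h2 : c * (L : ℝ) ^ δ * Real.exp (-γ * t) ≤ c * (2 * R + 3) ^ δ * Real.exp (-γ * t) := by
      gcongr
    have h3 : 0 ≤ Real.exp (-R) * lrConst D (b + r + 1) * Real.exp (lrVelocity D (r + 2) * t) := by
      positivity
    linarith
  push Not at hLR
  obtain ⟨L', hL'⟩ : ∃ L', L' = 2 * R + 3 := ⟨_, rfl⟩
  have : NeZero L' := ⟨by omega⟩
  have hinj := torusLift_injective (D := D) (L := L) (L' := L') (by omega)
  obtain ⟨B, hB⟩ := hA
  -- the same observable on the smaller torus
  choose x hxX hx using fun s : toTorus L '' (X : Set (Fin D → ℤ)) => s.2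
  have hxR : ∀ s i, 2 * (x s i).natAbs < L' := fun s i => by
    have h1 := (Finset.single_le_sum (f := fun i => (x s i).natAbs)
      (fun _ _ => Nat.zero_le _) (Finset.mem_univ i)).trans (hX _ (hxX s))
    omega
  have hfg : (Subtype.val : toTorus L '' (X : Set (Fin D → ℤ)) → Torus D L) =
      torusLift L' L ∘ fun s => toTorus L' (x s) := by
    funext s
    rw [Function.comp_apply, torusLift_toTorus (hxR s), hx s]
  set A' : Obs D L' q := embedObs (fun s => toTorus L' (x s)) B with hA'
  have hAA' : A = embedObs (torusLift L' L) A' := by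
    rw [hB, hfg, embedObs_comp hinj]
  have hnorm : ‖A‖ = ‖A'‖ := by rw [hAA', norm_embedObs hinj]
  have hkill : ∀ u, ¬ torusDist 0 u ≤ b + r + 1 → localTerm ℓ L u A = 0 := fun u hu => by
    rw [hB]
    exact localTerm_embedObs_eq_zero hℓ hL (torusDist_zero_le_of_mem_image hX) (by omega) B
  have hkill' : ∀ u, ¬ torusDist 0 u ≤ b + r + 1 → localTerm ℓ L' u A' = 0 := fun u hu =>
    localTerm_embedObs_eq_zero hℓ (by omega) (fun s => (torusDist_zero_toTorus_le (x s)).trans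
      (hX _ (hxX s))) (by omega) B
  have e1 := norm_evolve_sub_evolve_cube_le hℓ hℓ1 hL r hkill (R := R) (by omega) ht
  have e2 := norm_evolve_sub_evolve_cube_le hℓ hℓ1 (by omega) r hkill' (R := R) (by omega) ht
  have e3 := hmix L' (by omega) A' t ht
  have e4 := evolve_cube_torusLift hℓ hL (L' := L') (by omega) (R := R) (by omega) A' ht
  rw [← hAA'] at e4
  set a := (A' * ρ L').trace
  have e5 : ‖evolve (cubeLiouvillian ℓ L R) t A - a • (1 : Obs D L q)‖ =
      ‖evolve (cubeLiouvillian ℓ L' R) t A' - a • (1 : Obs D L' q)‖ := by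
    rw [e4, ← norm_embedObs hinj (evolve (cubeLiouvillian ℓ L' R) t A' - a • (1 : Obs D L' q))]
    congr 1
    have := map_sub (embedObsHom (q := q) _ hinj) (evolve (cubeLiouvillian ℓ L' R) t A')
      (a • (1 : Obs D L' q))
    rw [map_smul, map_one] at this
    exact this.symm
  refine ⟨a, ?_⟩
  have hcast : (L' : ℝ) = 2 * R + 3 := by rw [hL']; push_cast; ring
  rw [hcast] at e3
  have t1 := norm_sub_le_norm_sub_add_norm_sub (evolve (liouvillian ℓ L) t A)
    (evolve (cubeLiouvillian ℓ L R) t A) (a • (1 : Obs D L q))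
  have t2 := norm_sub_le_norm_sub_add_norm_sub (evolve (cubeLiouvillian ℓ L' R) t A')
    (evolve (liouvillian ℓ L') t A') (a • (1 : Obs D L' q))
  rw [norm_sub_rev _ (evolve (liouvillian ℓ L') t A')] at t2
  rw [hnorm] at e1 ⊢
  linarith

/-- The total effect of local perturbations on an evolved local observable. -/
lemma sum_norm_perturbation_le (hℓ : IsLindblad ℓ) (hℓ1 : cbNorm ℓ ≤ 1)
    {ρ : ∀ (L : ℕ) [NeZero L], Obs D L q} {c δ γ : ℝ} (hc : 0 < c) (hδ : 0 < δ)
    (hmix : ∀ (L : ℕ) [NeZero L], 3 ≤ L → ∀ (A : Obs D L q) (t : ℝ), 0 ≤ t →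
      ‖evolve (liouvillian ℓ L) t A - (A * ρ L).trace • (1 : Obs D L q)‖ ≤
        c * (L : ℝ) ^ δ * Real.exp (-γ * t) * ‖A‖)
    {X : Finset (Fin D → ℤ)} {b : ℕ} (hX : ∀ x ∈ X, ∑ i, (x i).natAbs ≤ b) {r : ℕ}
    {L : ℕ} [NeZero L] (hL : 3 ≤ L) {ε : ℝ} (hε : 0 ≤ ε) {E : Torus D L → SuperOp (Config D L q)}
    (hEsupp : ∀ u, SuperSupportedOn {v | torusDist u v ≤ r} (E u))
    (hELind : ∀ u, IsLindblad (localTerm ℓ L u + E u))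
    (hEnorm : ∀ u, cbNorm (E u) ≤ ENNReal.ofReal ε) {A : Obs D L q}
    (hA : ObsSupportedOn (toTorus L '' (X : Set (Fin D → ℤ))) A) {t : ℝ} (ht : 0 ≤ t) :
    ∑ u, ‖E u (evolve (liouvillian ℓ L) t A)‖ ≤
      ((2 * (coneRadius (lrVelocity D (r + 2)) b t : ℝ) + 1) ^ D *
        (2 * (lrConst D (b + r + 1) * Real.exp (-t)) +
          c * (2 * (coneRadius (lrVelocity D (r + 2)) b t : ℝ) + 3) ^ δ * Real.exp (-γ * t)) +
        lrConst D (b + r + 1) * Real.exp (-t)) * ‖A‖ * ε := by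
  classical
  set G := lrConst D (b + r + 1)
  set M := lrVelocity D (r + 2)
  set R := coneRadius M b t with hRdef
  have hG : 0 ≤ G := lrConst_nonneg D _
  have hcone : Real.exp (-(R : ℝ)) * Real.exp (M * t) ≤ Real.exp (-t) :=
    exp_neg_coneRadius_le M b t
  have hone : ∀ u, E u 1 = 0 := fun u => by
    have := (hELind u).map_one
    rwa [LinearMap.add_apply, (hℓ.localTerm hL u).map_one, zero_add] at this
  have hE : ∀ u B, ‖E u B‖ ≤ ε * ‖B‖ := fun u => norm_superOp_le hε (hEnorm u)
  obtain ⟨a, ha⟩ := exists_norm_evolve_sub_smul_one_le hℓ hℓ1 hc hδ hmix hX r hL hA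
    (R := R) (by rw [hRdef, coneRadius]; omega) ht
  set y := evolve (liouvillian ℓ L) t A
  have hnear : ∀ u, ‖E u y‖ ≤
      ε * ((2 * (G * Real.exp (-t)) + c * (2 * (R : ℝ) + 3) ^ δ * Real.exp (-γ * t)) * ‖A‖) := by
    intro u
    have : E u y = E u (y - a • 1) := by rw [map_sub, map_smul, hone, smul_zero, sub_zero]
    rw [this]
    refine (hE u _).trans (mul_le_mul_of_nonneg_left (ha.trans ?_) hε)
    gcongr ?_ * _
    have h1 : Real.exp (-(R : ℝ)) * G * Real.exp (M * t) ≤ G * Real.exp (-t) :=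
      calc _ = G * (Real.exp (-(R : ℝ)) * Real.exp (M * t)) := by ring
        _ ≤ _ := mul_le_mul_of_nonneg_left hcone hG
    linarith
  have hfar : ∑ u, Real.exp (torusDist 0 u) * ‖E u y‖ ≤ ε * (G * ‖A‖ * Real.exp (M * t)) := by
    obtain ⟨B, rfl⟩ := hA
    choose T' hT' using hEsupp
    refine (evolve_lieb_robinson hℓ hℓ1 hL (fun u hu => ?_) hε hE (fun u hu => ?_)
      (fun u v huv B => ?_) ht).2
    · exact localTerm_embedObs_eq_zero hℓ hL (torusDist_zero_le_of_mem_image hX) (by omega) B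
    · rw [hT' u]
      refine embedSuper_embedObs_eq_zero Subtype.val_injective (u := u) (m := r) ?_ ?_
        (torusDist_zero_le_of_mem_image hX) (by omega) B
      · rintro _ ⟨s, rfl⟩
        exact s.2
      · rw [← hT' u]
        exact hone u
    · rw [hT' u]
      refine embedSuper_localTerm_comm (u := u) (m := r) ?_ (by omega) _ B
      rintro _ ⟨s, rfl⟩
      exact s.2
  have hfar' : ∑ u with ¬ torusDist 0 u ≤ R, ‖E u y‖ ≤ ε * (G * ‖A‖ * Real.exp (-t)) := by
    have h1 : Real.exp R * ∑ u with ¬ torusDist 0 u ≤ R, ‖E u y‖ ≤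
        ε * (G * ‖A‖ * Real.exp (M * t)) := by
      refine le_trans ?_ hfar
      rw [Finset.mul_sum]
      refine (Finset.sum_le_sum fun u hu => ?_).trans (Finset.sum_le_sum_of_subset_of_nonneg
        (Finset.filter_subset _ _) fun u _ _ => by positivity)
      have hu : R ≤ torusDist 0 u := by
        have := (Finset.mem_filter.mp hu).2
        omega
      gcongr
    rw [mul_comm, ← le_div_iff₀ (Real.exp_pos _), div_eq_mul_inv, ← Real.exp_neg] at h1
    calc _ ≤ _ := h1
      _ = ε * (G * ‖A‖ * (Real.exp (-(R : ℝ)) * Real.exp (M * t))) := by ring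
      _ ≤ _ := by gcongr
  have hnear' : ∑ u with torusDist 0 u ≤ R, ‖E u y‖ ≤ (2 * (R : ℝ) + 1) ^ D *
      (ε * ((2 * (G * Real.exp (-t)) + c * (2 * (R : ℝ) + 3) ^ δ * Real.exp (-γ * t)) * ‖A‖)) := by
    refine (Finset.sum_le_card_nsmul _ _ _ fun u _ => hnear u).trans ?_
    rw [nsmul_eq_mul]
    gcongr
    exact_mod_cast card_torusDist_le (0 : Torus D L) R
  rw [← Finset.sum_filter_add_sum_filter_not Finset.univ fun u => torusDist 0 u ≤ R]
  calc _ ≤ _ := add_le_add hnear' hfar'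
    _ = _ := by ring

lemma norm_evolve_sub_evolve_perturbed_le {ι : Type} [Fintype ι] [DecidableEq ι]
    {T P : SuperOp ι} (hT : IsLindblad (T + P)) {A : Matrix ι ι ℂ} {a κ : ℝ} (ha : 0 ≤ a)
    (hκ : 0 < κ)
    (hP : ∀ t, 0 ≤ t → ‖P (evolve T t A)‖ ≤ a * Real.exp (-κ * t)) {t : ℝ} (ht : 0 ≤ t) :
    ‖evolve T t A - evolve (T + P) t A‖ ≤ a / κ := by
  have hder : ∀ t, HasDerivAt (fun t => evolve T t A - evolve (T + P) t A)
      ((T + P) (evolve T t A - evolve (T + P) t A) + -P (evolve T t A)) t := fun t => by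
    refine ((hasDerivAt_evolve T A t).sub (hasDerivAt_evolve (T + P) A t)).congr_deriv ?_
    rw [map_sub, LinearMap.add_apply, LinearMap.add_apply]
    abel
  have hB : ∀ t, HasDerivAt (fun s => a / κ * (1 - Real.exp (-κ * s)))
      (a * Real.exp (-κ * t)) t := fun t => by
    have := ((((hasDerivAt_id t).const_mul (-κ)).exp).const_sub 1).const_mul (a / κ)
    refine this.congr_deriv ?_
    field_simp
    simp
  refine (hT.dissipative.norm_le hder hB (fun s hs => ?_) ?_ ht).trans ?_
  · rw [norm_neg]
    exact hP s hs
  · simp [evolve_zero]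
  · refine mul_le_of_le_one_right (by positivity) ?_
    linarith [Real.exp_pos (-κ * t)]

end Stability

theorem theorem1
    -- lattice dimension, number of levels per site, local term of the Liouvillian
    (D q : ℕ) (ℓ : SuperOp (NbhdSite D → Fin q))
    (hℓ : IsLindblad ℓ) (hℓ1 : cbNorm ℓ ≤ 1)
    -- unique fixed point for every system size
    (ρ : ∀ (L : ℕ) [NeZero L], Obs D L q)
    (hρ : ∀ (L : ℕ) [NeZero L], 3 ≤ L → IsUniqueFixedPoint (liouvillian ℓ L) (ρ L))
    -- rapid mixing, with constants independent of the system size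
    (c δ γ : ℝ) (hc : 0 < c) (hδ : 0 < δ) (hγ : 0 < γ)
    (hmix : ∀ (L : ℕ) [NeZero L], 3 ≤ L → ∀ (A : Obs D L q) (t : ℝ), 0 ≤ t →
      ‖evolve (liouvillian ℓ L) t A - (A * ρ L).trace • (1 : Obs D L q)‖ ≤
        c * (L : ℝ) ^ δ * Real.exp (-γ * t) * ‖A‖)
    -- range of the perturbation, region
    (r : ℕ) (X : Finset (Fin D → ℤ)) :
    ∃ C : ℝ, 0 < C ∧ ∀ (L : ℕ) [NeZero L], 3 ≤ L →
      ∀ (ε : ℝ), 0 ≤ ε → ∀ E : Torus D L → SuperOp (Config D L q),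
        (∀ u, SuperSupportedOn {v | torusDist u v ≤ r} (E u)) →
        (∀ u, IsLindblad (localTerm ℓ L u + E u)) →
        (∀ u, cbNorm (E u) ≤ ENNReal.ofReal ε) →
        -- stability of observables supported on the region
        (∀ A : Obs D L q, ObsSupportedOn (toTorus L '' (X : Set (Fin D → ℤ))) A →
          ∀ t : ℝ, 0 ≤ t →
            ‖evolve (liouvillian ℓ L) t A - evolve (liouvillian ℓ L + ∑ u, E u) t A‖ ≤
              C * ‖A‖ * ε) ∧
        -- stability of `k`-point correlation functions in any initial state
        (∀ (k : ℕ) (x : Fin k → Fin D → ℤ), (∀ j, x j ∈ X) →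
          ∀ B : Fin k → Obs D L q, (∀ j, ObsSupportedOn {toTorus L (x j)} (B j)) →
          ∀ σ : Obs D L q, IsDensity σ → ∀ t : ℝ, 0 ≤ t →
            ‖(σ * evolve (liouvillian ℓ L) t (List.ofFn B).prod).trace -
              (σ * evolve (liouvillian ℓ L + ∑ u, E u) t (List.ofFn B).prod).trace‖ ≤
              C * (∏ j, ‖B j‖) * ε) := by
  classical
  obtain ⟨b, hb⟩ : ∃ b : ℕ, ∀ x ∈ X, ∑ i, (x i).natAbs ≤ b :=
    ⟨X.sup fun x => ∑ i, (x i).natAbs, fun x hx =>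
      Finset.le_sup (f := fun x : Fin D → ℤ => ∑ i, (x i).natAbs) hx⟩
  obtain ⟨C, κ, hC, hκ, hrate⟩ := exists_rate_bound D b δ (lrConst_nonneg D (b + r + 1))
    (zero_le_one.trans (one_le_lrVelocity D (r + 2))) hc.le hγ
  refine ⟨C / κ, by positivity, fun L _ hL ε hε E hEsupp hELind hEnorm => ?_⟩
  have hLind : IsLindblad (liouvillian ℓ L + ∑ u, E u) := by
    rw [liouvillian, ← Finset.sum_add_distrib]
    exact IsLindblad.sum _ _ fun u _ => hELind u
  have hobs : ∀ A : Obs D L q, ObsSupportedOn (toTorus L '' (X : Set (Fin D → ℤ))) A →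
      ∀ t : ℝ, 0 ≤ t →
        ‖evolve (liouvillian ℓ L) t A - evolve (liouvillian ℓ L + ∑ u, E u) t A‖ ≤
          C / κ * ‖A‖ * ε := by
    intro A hA t ht
    rw [show C / κ * ‖A‖ * ε = C * ‖A‖ * ε / κ by ring]
    refine norm_evolve_sub_evolve_perturbed_le hLind (by positivity) hκ (fun s hs => ?_) ht
    rw [LinearMap.sum_apply]
    refine (norm_sum_le _ _).trans ((sum_norm_perturbation_le hℓ hℓ1 hc hδ hmix hb hL hε hEsupp
      hELind hEnorm hA hs).trans ?_)
    rw [show C * ‖A‖ * ε * Real.exp (-κ * s) = C * Real.exp (-κ * s) * ‖A‖ * ε by ring]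
    gcongr
    exact hrate s hs
  refine ⟨hobs, fun k x hx B hB σ hσ t ht => ?_⟩
  rw [← Matrix.trace_sub, ← mul_sub]
  refine (hσ.norm_trace_mul_le _).trans ((hobs _ ?_ t ht).trans ?_)
  · refine ObsSupportedOn.list_prod _ fun A hA => ?_
    obtain ⟨j, rfl⟩ := List.mem_ofFn.mp hA
    exact (hB j).mono (Set.singleton_subset_iff.mpr (Set.mem_image_of_mem _ (hx j)))
  · gcongr
    refine (norm_list_prod_le _).trans_eq ?_
    rw [List.map_ofFn, List.prod_ofFn]
    rfl
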